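/- **Theorem (Boson Sampling verification).** *Setting.* Let $m\ge1$ and $0\le n\le m$, let $U$ be an $m\times m$ unitary matrix, and let $\hat U$ be the $m$-mode passive linear transformation with $\hat U a_j^\dagger\hat U^\dagger=\sum_iU_{ij}a_i^\dagger$ and $\hat U|0\cdots0\rangle=|0\cdots0\rangle$. Let $|\psi\rangle=\hat U|1\cdots10\cdots0\rangle$ ($n$ photons in $m$ modes) be the target state, and let $\rho$ be an unknown $m$-mode density operator. Let $N,M\ge1$ and $\lambda>\epsilon>0$, let $p\ge2$ be even, and let $0<\eta<1$. For $k\in\{0,1\}$ and $z\in\mathbb C$ put $$g_{k}(z)=\sum_{j=0}^{p-1}(-1)^j\eta^j\binom{k+j}{k}f_{k+j}(z),\qquad f_{l}(z)=\frac{e^{(1-1/\eta)|z|^2}}{\eta^{1+l}}\sum_{q=0}^{l}\frac{l!\,(-1)^q}{q!\,((l-q)!)^2}\left(\frac{|z|^2}{\eta}\right)^{l-q}.$$ *Protocol.* Given $\rho^{\otimes(N+M)}$, measure $N$ copies of $\rho$ with balanced heterodyne detection of all modes, that is, sample $\gamma^{(1)},\dots,\gamma^{(N)}\in\mathbb C^m$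 independently from the density $\langle\gamma|\rho|\gamma\rangle/\pi^m$, where $|\gamma\rangle$ is the $m$-mode coherent state. Compute $\alpha^{(k)}=U^\dagger\gamma^{(k)}$. Let $F_i=\frac1N\sum_{k}g_{1}(\alpha_i^{(k)})$ for $i\le n$ and $F_i=\frac1N\sum_kg_{0}(\alpha_i^{(k)})$ for $i>n$. Let $\tau(F_i)=\max(0,\min(1,F_i))$ be the truncation of the estimate to $[0,1]$. (If $M$ is odd and $\lambda\le1$, the truncation may also be omitted: $\tau(F_i)=F_i$.) Let $W=1-\sum_{i=1}^m\left(1-\tau(F_i)^M\right)$. Abort if $W<1-\lambda+\epsilon$. Otherwise accept and measure all modes of each of the $M$ remaining copies, either with unbalanced heterodyne detection with any unbalancing parameters $\xi\in\mathbb C^m$ (outcome density $\langle s,\xi|\rho|s,\xi\rangle/\pi^m$, where $|s,\xi\rangle=\bigotimes_i\hat S(\xi_i)\hat D(s_i)|0\rangle$), or with photon counting or single-photon threshold detection, to obtain $s^{(1)},\dots,s^{(M)}$. *Claim.* There is a constant $C>0$ that depends only on the free parameters $p$ and $\eta$ such that, for all $m,n,U,M,N,\lambda,\epsilon$ as above and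 all $\delta>0$: 1. (Soundness) If $N\ge C\left(\frac{Mm}{\epsilon}\right)^2\max(1,\log m)\,\max(1,\log\frac1\delta)$, then for every density operator $\rho$, with probability at least $1-\delta$, either the protocol aborts or the samples $(s^{(1)},\dots,s^{(M)})$ are drawn from a joint probability distribution whose total variation distance to the ideal Boson Sampling distribution (the one obtained in the same way from $|\psi\rangle\langle\psi|^{\otimes M}$) is less than $\sqrt\lambda$. 2. (Completeness) If $\rho=|\psi\rangle\langle\psi|$ and $N\ge C\left(\frac{Mm}{\min(\epsilon,\lambda-\epsilon)}\right)^2\max(1,\log m)\,\max(1,\log\frac1\delta)$, then the protocol accepts with probability at least $1-\delta$. For $\lambda\ge2\epsilon$ this is the same number of samples as in 1. -/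

import Mathlib

open MeasureTheory
open scoped Matrix ENNReal

noncomputable section

namespace BosonSampling

/-! ## The `m`-mode Hilbert space, density operators -/

/-- The `m`-mode Hilbert space `⨂ᵢ ℓ²(ℕ) = ℓ²(ℕᵐ)`, in the Fock (photon number) representation. -/
abbrev FockSpace (m : ℕ) : Type := lp (fun _ : Fin m → ℕ => ℂ) 2

/-- The Fock basis vector `|k₁ … k_m⟩`. -/
def fockState {m : ℕ} (k : Fin m → ℕ) : FockSpace m := lp.single 2 k (1 : ℂ)

/-- Density operators: positive operators of trace one (the trace of a positive operator is the
sum of its diagonal elements in the Fock basis). -/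
def IsDensity {m : ℕ} (ρ : FockSpace m →L[ℂ] FockSpace m) : Prop :=
  ρ.IsPositive ∧ HasSum (fun k : Fin m → ℕ => inner ℂ (fockState k) (ρ (fockState k))) 1

/-- The pure state `|φ⟩⟨φ|`. -/
def pureState {m : ℕ} (φ : FockSpace m) : FockSpace m →L[ℂ] FockSpace m :=
  InnerProductSpace.rankOne ℂ φ φ

/-! ## Passive linear transformations and the Boson Sampling target state -/

/-- Finite superpositions of Fock states. -/
abbrev FiniteFock (m : ℕ) : Type := (Fin m → ℕ) →₀ ℂ

/-- The creation operator of mode `i`: `aᵢ† |k⟩ = √(kᵢ + 1) |k + eᵢ⟩`. -/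
def creation {m : ℕ} (i : Fin m) : FiniteFock m →ₗ[ℂ] FiniteFock m :=
  Finsupp.lsum ℂ fun k : Fin m → ℕ =>
    ((Real.sqrt (k i + 1) : ℝ) : ℂ) • Finsupp.lsingle (k + Pi.single i 1)

/-- The image `Û aⱼ† Û† = ∑ᵢ Uᵢⱼ aᵢ†` of the creation operator of mode `j` under the passive linear
transformation `Û` with matrix `U`. -/
def rotatedCreation {m : ℕ} (U : Matrix (Fin m) (Fin m) ℂ) (j : Fin m) :
    FiniteFock m →ₗ[ℂ] FiniteFock m :=
  ∑ i : Fin m, U i j • creation i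

/-- The passive linear transformation `Û` with matrix `U`, on finite superpositions of Fock states
(which it maps to each other): `Û |l⟩ = ∏ⱼ (l_j!)^(-1/2) (Û aⱼ† Û†)^(l_j) |0…0⟩`. The factors of the
product commute. -/
def passiveLinear {m : ℕ} (U : Matrix (Fin m) (Fin m) ℂ) : FiniteFock m →ₗ[ℂ] FiniteFock m :=
  Finsupp.lsum ℂ fun l : Fin m → ℕ =>
    LinearMap.toSpanSingleton ℂ (FiniteFock m)
      ((((Real.sqrt (∏ j : Fin m, ((l j).factorial : ℝ)))⁻¹ : ℝ) : ℂ) •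
        (List.ofFn fun j : Fin m => rotatedCreation U j ^ l j).prod (Finsupp.single 0 1))

/-- A finite superposition of Fock states, as a vector of the Hilbert space. -/
def toFockSpace {m : ℕ} (c : FiniteFock m) : FockSpace m :=
  c.sum fun k a => a • fockState k

/-- The input pattern `1…10…0`: one photon in each of the first `n` modes, vacuum in the others. -/
def inputPattern (m n : ℕ) (i : Fin m) : ℕ := if (i : ℕ) < n then 1 else 0

/-- The Boson Sampling target state `|ψ⟩ = Û |1…10…0⟩`. -/
def targetState {m : ℕ} (U : Matrix (Fin m) (Fin m) ℂ) (n : ℕ) : FockSpace m :=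
  toFockSpace (passiveLinear U (Finsupp.single (inputPattern m n) 1))

/-! ## Coherent states and squeezed coherent states -/

lemma summable_pi_prod {m : ℕ} {f : Fin m → ℕ → ℝ} (h0 : ∀ i k, 0 ≤ f i k)
    (hf : ∀ i, Summable (f i)) : Summable fun k : Fin m → ℕ => ∏ i, f i (k i) := by
  classical
  refine summable_of_sum_le (c := ∏ i, ∑' k, f i k)
    (fun k => Finset.prod_nonneg fun i _ => h0 i _) fun s => ?_
  calc ∑ k ∈ s, ∏ i, f i (k i)
      ≤ ∑ k ∈ Fintype.piFinset (fun i => s.image fun k => k i), ∏ i, f i (k i) := by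
        refine Finset.sum_le_sum_of_subset_of_nonneg ?_
          fun k _ _ => Finset.prod_nonneg fun i _ => h0 i _
        intro k hk
        exact Fintype.mem_piFinset.2 fun i => Finset.mem_image_of_mem _ hk
    _ = ∏ i, ∑ k ∈ s.image (fun k => k i), f i k := (Finset.prod_univ_sum _ _).symm
    _ ≤ ∏ i, ∑' k, f i k := by
        refine Finset.prod_le_prod (fun i _ => Finset.sum_nonneg fun k _ => h0 i k) fun i _ => ?_
        exact (hf i).sum_le_tsum _ fun k _ => h0 i k

lemma memℓp_prod {m : ℕ} {f : Fin m → ℕ → ℂ} (hf : ∀ i, Summable fun k => ‖f i k‖) :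
    Memℓp (fun k : Fin m → ℕ => ∏ i, f i (k i)) 2 := by
  have h1 : Memℓp (fun k : Fin m → ℕ => ∏ i, f i (k i)) 1 := by
    refine memℓp_gen ?_
    simpa [norm_prod] using summable_pi_prod (fun i k => norm_nonneg (f i k)) hf
  exact h1.of_exponent_ge (by norm_num)

/-- The Fock amplitude `⟨k|α⟩ = exp(-|α|²/2) α^k / √(k!)` of the coherent state `|α⟩`. -/
def coherentAmp (α : ℂ) (k : ℕ) : ℂ :=
  Complex.exp (-(‖α‖ ^ 2 / 2 : ℝ)) * α ^ k / (Real.sqrt k.factorial : ℝ)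

/-- The parameter `e^{iθ} tanh r` of `ξ = r e^{iθ}`. -/
def squeezeTanh (ξ : ℂ) : ℂ := Complex.exp (Complex.arg ξ * Complex.I) * (Real.tanh ‖ξ‖ : ℝ)

/-- The Fock amplitude `⟨k|α, ξ⟩` of the squeezed coherent state `|α, ξ⟩ = Ŝ(ξ) D̂(α)|0⟩`, where
`Ŝ(ξ) = exp((ξ* a² - ξ a†²)/2)` and `D̂(α) = exp(α a† - α* a)`. With `ξ = r e^{iθ}` and
`t = e^{iθ} tanh r`, the normally ordered form
`Ŝ(ξ) = exp(-t a†²/2) (cosh r)^(-a†a-1/2) exp(t* a²/2)` gives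
`|α, ξ⟩ = (cosh r)^(-1/2) exp(-|α|²/2 + t* α²/2) exp(-t a†²/2 + (α / cosh r) a†) |0⟩`. -/
def squeezedAmp (α ξ : ℂ) (k : ℕ) : ℂ :=
  ((Real.sqrt (Real.cosh ‖ξ‖))⁻¹ : ℝ) *
    Complex.exp (-(‖α‖ ^ 2 / 2 : ℝ) + star (squeezeTanh ξ) * α ^ 2 / 2) *
    ((Real.sqrt k.factorial : ℝ) * ∑ a ∈ Finset.range (k / 2 + 1),
      (-squeezeTanh ξ / 2) ^ a / (a.factorial : ℂ) *
        ((α / (Real.cosh ‖ξ‖ : ℝ)) ^ (k - 2 * a) / ((k - 2 * a).factorial : ℂ)))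

lemma squeezedAmp_zero (α : ℂ) (k : ℕ) : squeezedAmp α 0 k = coherentAmp α k := by
  have hk : (Real.sqrt k.factorial : ℝ) ^ 2 = (k.factorial : ℝ) :=
    Real.sq_sqrt (by positivity)
  have hk0 : ((Real.sqrt k.factorial : ℝ) : ℂ) ≠ 0 := by
    have : 0 < Real.sqrt k.factorial := Real.sqrt_pos.2 (by positivity)
    exact_mod_cast this.ne'
  have hk' : ((Real.sqrt k.factorial : ℝ) : ℂ) ^ 2 = (k.factorial : ℂ) := by exact_mod_cast hk
  have ht : squeezeTanh 0 = 0 := by simp [squeezeTanh]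
  unfold squeezedAmp coherentAmp
  rw [ht, Finset.sum_range_succ', Finset.sum_eq_zero]
  · simp only [norm_zero, Real.cosh_zero]
    have : (k.factorial : ℂ) ≠ 0 := by exact_mod_cast k.factorial_ne_zero
    simp
    rw [← hk']
    field_simp
  · intro a _
    simp

lemma squeeze_term_bound {t β u w : ℝ} (ht : 0 ≤ t) (hu : 0 < u) (hu1 : u < 1) (hw : 0 < w)
    (htu : t ≤ u * w ^ 2) (a b : ℕ) :
    ((2 * a + b).factorial : ℝ) * ((t / 2) ^ a / a.factorial * (β ^ b / b.factorial)) ^ 2 ≤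
      (w ^ (2 * a + b)) ^ 2 * Real.exp (β ^ 2 / (w ^ 2 * (1 - u))) := by
  have hv : 0 < 1 - u := by linarith
  set x : ℝ := β ^ 2 / (w ^ 2 * (1 - u)) with hx
  have hx0 : 0 ≤ x := by positivity
  have hexp : x ^ b / b.factorial ≤ Real.exp x := Real.pow_div_factorial_le_exp x hx0 b
  have hA : (0 : ℝ) < a.factorial := by positivity
  have hB : (0 : ℝ) < b.factorial := by positivity
  have hch : ((2 * a + b).factorial : ℝ) =
      ((2 * a + b).choose (2 * a) : ℝ) * ((2 * a).factorial * b.factorial) := by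
    have := Nat.add_choose_mul_factorial_mul_factorial (2 * a) b
    rw [Nat.choose_symm_add.symm] at this
    rw [← mul_assoc]
    exact_mod_cast this.symm
  have hbin : ((2 * a + b).choose (2 * a) : ℝ) * (u ^ (2 * a) * (1 - u) ^ b) ≤ 1 := by
    have h := add_pow u (1 - u) (2 * a + b)
    rw [add_sub_cancel, one_pow] at h
    have h2 := Finset.single_le_sum
      (f := fun j => u ^ j * (1 - u) ^ (2 * a + b - j) * ((2 * a + b).choose j : ℝ))
      (s := Finset.range (2 * a + b + 1)) (fun j _ => by positivity)
      (Finset.mem_range.2 (by omega : 2 * a < 2 * a + b + 1))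
    simp only [Nat.add_sub_cancel_left] at h2
    rw [← h] at h2
    linarith
  have hcent : ((2 * a).factorial : ℝ) ≤ 4 ^ a * (a.factorial : ℝ) ^ 2 := by
    have h1 : (2 * a).factorial = (2 * a).choose a * (a.factorial * a.factorial) := by
      have := Nat.add_choose_mul_factorial_mul_factorial a a
      rw [← two_mul] at this
      rw [← this]; ring
    have h2 : (2 * a).choose a ≤ 4 ^ a := by
      have := Nat.choose_le_two_pow (2 * a) a
      rwa [pow_mul] at this
    rw [h1]; push_cast
    have : ((2 * a).choose a : ℝ) ≤ 4 ^ a := by exact_mod_cast h2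
    nlinarith [mul_le_mul_of_nonneg_right this (by positivity : (0:ℝ) ≤ a.factorial * a.factorial)]
  have ht2 : t ^ (2 * a) ≤ u ^ (2 * a) * (w ^ 2) ^ (2 * a) := by
    rw [← mul_pow]; exact pow_le_pow_left₀ ht htu _
  have hβ : β ^ (2 * b) = x ^ b * (w ^ 2) ^ b * (1 - u) ^ b := by
    rw [← mul_pow, ← mul_pow, pow_mul, hx]; congr 1; field_simp
  calc ((2 * a + b).factorial : ℝ) * ((t / 2) ^ a / a.factorial * (β ^ b / b.factorial)) ^ 2
      = ((2 * a + b).choose (2 * a) : ℝ) * (t ^ (2 * a) * β ^ (2 * b)) / b.factorial *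
          ((2 * a).factorial / (4 ^ a * (a.factorial : ℝ) ^ 2)) := by
        rw [hch, show (4 : ℝ) ^ a = (2 ^ a) ^ 2 by rw [← pow_mul, mul_comm, pow_mul]; norm_num,
          pow_mul' t, pow_mul' β, div_pow]
        field_simp
    _ ≤ ((2 * a + b).choose (2 * a) : ℝ) * (t ^ (2 * a) * β ^ (2 * b)) / b.factorial * 1 := by
        have : ((2 * a).factorial : ℝ) / (4 ^ a * (a.factorial : ℝ) ^ 2) ≤ 1 :=
          (div_le_one (by positivity)).2 hcent
        have h0 : 0 ≤ β ^ (2 * b) := by rw [pow_mul]; positivity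
        gcongr
    _ ≤ ((2 * a + b).choose (2 * a) : ℝ) *
          ((u ^ (2 * a) * (w ^ 2) ^ (2 * a)) * β ^ (2 * b)) / b.factorial * 1 := by
        have h0 : 0 ≤ β ^ (2 * b) := by rw [pow_mul]; positivity
        gcongr
    _ = (((2 * a + b).choose (2 * a) : ℝ) * (u ^ (2 * a) * (1 - u) ^ b)) *
          ((w ^ (2 * a + b)) ^ 2 * (x ^ b / b.factorial)) := by
        rw [hβ]; ring
    _ ≤ 1 * ((w ^ (2 * a + b)) ^ 2 * Real.exp x) := by gcongr
    _ = _ := one_mul _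

lemma summable_squeezedAmp (α ξ : ℂ) : Summable fun k => ‖squeezedAmp α ξ k‖ := by
  set t := ‖squeezeTanh ξ‖ with htdef
  have ht : 0 ≤ t := norm_nonneg _
  have ht1 : t < 1 := by
    rw [htdef, squeezeTanh, norm_mul, Complex.norm_exp_ofReal_mul_I, one_mul, Complex.norm_real,
      Real.norm_eq_abs]
    exact Real.abs_tanh_lt_one _
  obtain ⟨u, w, hu, hu1, hw, hw1, htu⟩ :
      ∃ u w : ℝ, 0 < u ∧ u < 1 ∧ 0 < w ∧ w < 1 ∧ t ≤ u * w ^ 2 := by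
    have hs : (2 + t) / 3 < 1 := by linarith
    refine ⟨(2 + t) / 3, (2 + t) / 3, by positivity, hs, by positivity, hs, ?_⟩
    nlinarith [mul_nonneg (sq_nonneg (1 - t)) (by linarith : (0 : ℝ) ≤ 8 + t)]
  set β : ℝ := ‖α / (Real.cosh ‖ξ‖ : ℝ)‖ with hβ
  set K : ℝ := Real.sqrt (Real.exp (β ^ 2 / (w ^ 2 * (1 - u)))) with hK
  have hterm : ∀ k a : ℕ, a ∈ Finset.range (k / 2 + 1) →
      Real.sqrt k.factorial * ((t / 2) ^ a / a.factorial *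
        (β ^ (k - 2 * a) / (k - 2 * a).factorial)) ≤ w ^ k * K := by
    intro k a ha
    have hk : 2 * a + (k - 2 * a) = k := by
      have := Finset.mem_range.1 ha
      omega
    have h := squeeze_term_bound (β := β) ht hu hu1 hw htu a (k - 2 * a)
    rw [hk] at h
    have hβ0 : 0 ≤ β := norm_nonneg _
    refine le_of_sq_le_sq ?_ (by positivity)
    rw [mul_pow, mul_pow (w ^ k), Real.sq_sqrt (by positivity), hK,
      Real.sq_sqrt (Real.exp_pos _).le]
    exact h
  set P : ℂ := ((Real.sqrt (Real.cosh ‖ξ‖))⁻¹ : ℝ) *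
    Complex.exp (-(‖α‖ ^ 2 / 2 : ℝ) + star (squeezeTanh ξ) * α ^ 2 / 2) with hP
  have hbound : ∀ k, ‖squeezedAmp α ξ k‖ ≤ ‖P‖ * K * (((k : ℝ) ^ 1 * w ^ k) + w ^ k) := by
    intro k
    have h1 : ‖squeezedAmp α ξ k‖ ≤ ‖P‖ * ∑ a ∈ Finset.range (k / 2 + 1), w ^ k * K := by
      unfold squeezedAmp
      rw [norm_mul, ← hP]
      gcongr
      rw [norm_mul, Complex.norm_real, Real.norm_of_nonneg (Real.sqrt_nonneg _)]
      calc _ ≤ Real.sqrt k.factorial * ∑ a ∈ Finset.range (k / 2 + 1),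
            ((t / 2) ^ a / a.factorial * (β ^ (k - 2 * a) / (k - 2 * a).factorial)) := by
            gcongr
            refine (norm_sum_le _ _).trans (le_of_eq (Finset.sum_congr rfl fun a _ => ?_))
            simp [htdef, hβ]
        _ ≤ _ := by
            rw [Finset.mul_sum]
            exact Finset.sum_le_sum (hterm k)
    refine h1.trans ?_
    rw [Finset.sum_const, Finset.card_range, nsmul_eq_mul, mul_assoc]
    have h2 : ((k / 2 + 1 : ℕ) : ℝ) ≤ (k : ℝ) + 1 := by
      have : k / 2 + 1 ≤ k + 1 := by omega
      exact_mod_cast this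
    have h3 : 0 ≤ w ^ k * K := by positivity
    have h4 := mul_le_mul_of_nonneg_right h2 h3
    have h5 : K * ((k : ℝ) ^ 1 * w ^ k + w ^ k) = ((k : ℝ) + 1) * (w ^ k * K) := by ring
    rw [h5]
    gcongr
  refine Summable.of_nonneg_of_le (fun k => norm_nonneg _) hbound (Summable.mul_left _ ?_)
  have hwn : ‖w‖ < 1 := by rwa [Real.norm_of_nonneg hw.le]
  exact (summable_pow_mul_geometric_of_norm_lt_one 1 hwn).add
    (summable_geometric_of_lt_one hw.le hw1)

lemma summable_coherentAmp (α : ℂ) : Summable fun k => ‖coherentAmp α k‖ := by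
  simpa [squeezedAmp_zero] using summable_squeezedAmp α 0

/-- The `m`-mode coherent state `|α⟩ = ⨂ᵢ |αᵢ⟩`. -/
def coherentState {m : ℕ} (α : Fin m → ℂ) : FockSpace m :=
  ⟨fun k => ∏ i, coherentAmp (α i) (k i), memℓp_prod fun i => summable_coherentAmp (α i)⟩

/-- The `m`-mode squeezed coherent state `|α, ξ⟩ = ⨂ᵢ Ŝ(ξᵢ) D̂(αᵢ)|0⟩`. -/
def squeezedState {m : ℕ} (α ξ : Fin m → ℂ) : FockSpace m :=
  ⟨fun k => ∏ i, squeezedAmp (α i) (ξ i) (k i), memℓp_prod fun i => summable_squeezedAmp (α i) (ξ i)⟩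

/-! ## Measurements: distributions of the outcomes -/

/-- Balanced heterodyne detection of the `m` modes of `ρ`: the density of the outcome
`α ∈ ℂᵐ` is the Husimi function `⟨α|ρ|α⟩ / π^m`. -/
def heterodyne {m : ℕ} (ρ : FockSpace m →L[ℂ] FockSpace m) : Measure (Fin m → ℂ) :=
  volume.withDensity fun α => ENNReal.ofReal
    ((inner ℂ (coherentState α) (ρ (coherentState α))).re / Real.pi ^ m)

/-- Unbalanced heterodyne detection of the `m` modes of `ρ` with unbalancing parameters `ξ`: the
POVM elements are `|α, ξ⟩⟨α, ξ| / π^m`. -/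
def unbalancedHeterodyne {m : ℕ} (ξ : Fin m → ℂ) (ρ : FockSpace m →L[ℂ] FockSpace m) :
    Measure (Fin m → ℂ) :=
  volume.withDensity fun α => ENNReal.ofReal
    ((inner ℂ (squeezedState α ξ) (ρ (squeezedState α ξ))).re / Real.pi ^ m)

/-- Photon counting in the `m` modes of `ρ`. -/
def photonCounting {m : ℕ} (ρ : FockSpace m →L[ℂ] FockSpace m) : Measure (Fin m → ℕ) :=
  Measure.count.withDensity fun k => ENNReal.ofReal
    (inner ℂ (fockState k) (ρ (fockState k))).re

/-- Threshold detection in the `m` modes of `ρ`: in each mode, the outcome is `1` if there is at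
least one photon and `0` otherwise. -/
def thresholdDetection {m : ℕ} (ρ : FockSpace m →L[ℂ] FockSpace m) : Measure (Fin m → ℕ) :=
  (photonCounting ρ).map fun k i => min (k i) 1

/-- The distribution of independent outcomes of the same measurement on each copy of
`ρ^{⊗ N}`, when `P` is the distribution for one copy. -/
def iid {Ω : Type*} [MeasurableSpace Ω] (N : ℕ) (P : Measure Ω) : Measure (Fin N → Ω) :=
  Measure.pi fun _ => P

/-- The total variation distance between two probability measures. -/
def tvDist {Ω : Type*} [MeasurableSpace Ω] (P Q : Measure Ω) : ℝ :=
  ⨆ A : {A : Set Ω // MeasurableSet A}, |P.real A - Q.real A|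

/-! ## The estimators -/

/-- The polynomials `𝓛_{k,l}(z) = ∑_q √(k!) √(l!) (-1)^q / (q! (k-q)! (l-q)!) z^(l-q) z*^(k-q)`. -/
def laguerre2D (k l : ℕ) (z : ℂ) : ℂ :=
  ∑ q ∈ Finset.range (min k l + 1),
    (Real.sqrt k.factorial : ℝ) * (Real.sqrt l.factorial : ℝ) * (-1) ^ q /
      ((q.factorial : ℂ) * ((k - q).factorial : ℂ) * ((l - q).factorial : ℂ)) *
        z ^ (l - q) * (star z) ^ (k - q)

/-- `f_{k,l}(z, η) = η^(-1-(k+l)/2) exp((1 - 1/η) |z|²) 𝓛_{l,k}(z / √η)`. -/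
def fEst (k l : ℕ) (z : ℂ) (η : ℝ) : ℂ :=
  ((1 / η ^ (1 + ((k : ℝ) + l) / 2) * Real.exp ((1 - 1 / η) * ‖z‖ ^ 2) : ℝ) : ℂ) *
    laguerre2D l k (z / (Real.sqrt η : ℝ))

/-- `g_{k,l}^{(p)}(z, η) = ∑_{j<p} (-1)^j η^j f_{k+j,l+j}(z, η) √(binom(k+j,k) binom(l+j,l))`. -/
def gEst (p k l : ℕ) (z : ℂ) (η : ℝ) : ℂ :=
  ∑ j ∈ Finset.range p, (-1) ^ j * (η : ℂ) ^ j * fEst (k + j) (l + j) z η *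
    (Real.sqrt ((k + j).choose k * (l + j).choose l : ℝ) : ℝ)

lemma laguerre2D_self_im (k : ℕ) (z : ℂ) : (laguerre2D k k z).im = 0 := by
  rw [← Complex.conj_eq_iff_im, laguerre2D, map_sum]
  refine Finset.sum_congr rfl fun q _ => ?_
  simp
  ring

/-- The functions `g_{k,k}^{(p)}` are real-valued. -/
lemma gEst_self_im (p k : ℕ) (z : ℂ) (η : ℝ) : (gEst p k k z η).im = 0 := by
  have h := fun j => Complex.conj_eq_iff_im.2 (laguerre2D_self_im (k + j) (z / (Real.sqrt η : ℝ)))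
  rw [← Complex.conj_eq_iff_im, gEst, map_sum]
  refine Finset.sum_congr rfl fun j _ => ?_
  simp only [fEst, map_mul, map_pow, map_neg, map_one, Complex.conj_ofReal, h]

/-! ## The protocol -/

/-- The samples `γ⁽¹⁾, …, γ⁽ᴺ⁾ ∈ ℂᵐ` are processed to `α⁽ᵏ⁾ = U† γ⁽ᵏ⁾`, and the estimate for mode
`i` is the mean over `α_i⁽¹⁾, …, α_i⁽ᴺ⁾` of the real-valued function `g_{|1⟩}^{(p)}(·, η)` for the
modes with a photon at the input, of `g_{|0⟩}^{(p)}(·, η)` for the others. -/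
def modeEstimate {m N : ℕ} (p : ℕ) (η : ℝ) (U : Matrix (Fin m) (Fin m) ℂ) (n : ℕ)
    (γ : Fin N → Fin m → ℂ) (i : Fin m) : ℝ :=
  (∑ k : Fin N, (gEst p (inputPattern m n i) (inputPattern m n i) ((Uᴴ *ᵥ γ k) i) η).re) / N

/-- The fidelity witness estimate `W = 1 - ∑ᵢ (1 - τ(Fᵢ)^M)`, where `Fᵢ` is the estimate for mode
`i`, and `τ` is applied to the estimated single-mode fidelities before they are raised to the
power `M`. -/
def witnessEstimate {m N : ℕ} (τ : ℝ → ℝ) (p : ℕ) (η : ℝ) (M : ℕ)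
    (U : Matrix (Fin m) (Fin m) ℂ) (n : ℕ) (γ : Fin N → Fin m → ℂ) : ℝ :=
  1 - ∑ i : Fin m, (1 - τ (modeEstimate p η U n γ i) ^ M)

/-- Truncation to the interval `[0, 1]` in which fidelities lie. -/
def truncate (x : ℝ) : ℝ := max 0 (min 1 x)

/-- The protocol aborts if `W < 1 - lam + ε`, and accepts otherwise. -/
def Aborts {m N : ℕ} (τ : ℝ → ℝ) (p : ℕ) (η lam ε : ℝ) (M : ℕ)
    (U : Matrix (Fin m) (Fin m) ℂ) (n : ℕ) (γ : Fin N → Fin m → ℂ) : Prop :=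
  witnessEstimate τ p η M U n γ < 1 - lam + ε

/-- The joint distribution of the samples `s⁽¹⁾, …, s⁽ᴹ⁾` obtained by measuring `M` copies of `ρ` is
at total variation distance less than `d` from that for `M` copies of `σ`, for
unbalanced heterodyne detection with any unbalancing parameters, for photon counting
and for threshold detection. -/
def SamplesClose {m : ℕ} (M : ℕ) (ρ σ : FockSpace m →L[ℂ] FockSpace m) (d : ℝ) : Prop :=
  (∀ ξ : Fin m → ℂ,
    tvDist (iid M (unbalancedHeterodyne ξ ρ)) (iid M (unbalancedHeterodyne ξ σ)) < d) ∧
  tvDist (iid M (photonCounting ρ)) (iid M (photonCounting σ)) < d ∧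
  tvDist (iid M (thresholdDetection ρ)) (iid M (thresholdDetection σ)) < d

end BosonSampling

end

open BosonSampling

/-!
Let `F = ⟨ψ|ρ|ψ⟩` be the fidelity of one copy with the target state. The witness estimates a lower
bound of the fidelity `F^M` of `M` copies, and `√(1 - F^M)` bounds the total variation distance for
every measurement with rank-one elements `|v x⟩⟨v x|` that resolve the identity
(`ResolvesIdentity`).

*Measurements.* If `v` resolves the identity, the outcome distributions of `ρ` and `|ψ⟩⟨ψ|` have
overlap `∫ √⟨v|ρ|v⟩ |⟨v|ψ⟩| ≥ √F` (`ResolvesIdentity.sqrt_weight_le_integral`). The overlap is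
multiplicative over independent samples, and the Cauchy-Schwarz inequality turns it into the
bound on the total variation distance (`ResolvesIdentity.tvDist_iid_outcome_le`). Photon
counting is the Fock basis, and threshold detection is a function of its outcome. For squeezed coherent states, the resolution of the identity in one
mode need only be checked on the total family `∑ₖ x^k / √(k!) |k⟩`, `x` real, where it is a
Gaussian integral (`integral_squeezedGen`); several modes follow by taking products.

*Passive transformations.* Coherent states are eigenvectors of the annihilation operators, so
that `⟨γ|Û|l⟩ = ⟨U†γ|l⟩` (`inner_rotatedFock_coherentState`). As `γ ↦ U†γ` preserves the volume
of phase space, the states `Û|l⟩` form an orthonormal basis (`resolvesIdentity_rotatedFock`),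
and heterodyne detection of `ρ` followed by `U†` has the same distribution as heterodyne
detection of `Û†ρÛ`.

*Estimators.* The mean of `g_k` over the Husimi function of the Fock state `|n⟩` is `1` for
`n = k`, `0` for `n < k`, and a nonnegative multiple of `(-1)^(p-1)` for `n > k` (`modeMean_gEst`).
The function `g_k` depends only on the modulus, hence is diagonal in the Fock basis. As `p` is
even, the expected estimate for a mode is at most the fidelity `φᵢ` of this mode with the Fock
state `|kᵢ⟩`, with equality for the target state, whatever the energy of `ρ`: no term of the
truncation error has to be bounded.

*Witness.* In the distribution of the photon numbers of `Û†ρÛ`, `F` is the probability of an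
intersection of events of probabilities `φᵢ`; the union bound for `M` independent samples gives
`1 - F^M ≤ ∑ᵢ (1 - φᵢ^M)` (`one_sub_weight_pow_le`). As `g_k` is bounded, Hoeffding's inequality
and a union bound over the modes control the deviations of the estimates.
-/

noncomputable section

namespace BosonSampling

/-! ### Resolutions of the identity -/

section ResolvesIdentity

variable {X H : Type*} [MeasurableSpace X] [NormedAddCommGroup H] [InnerProductSpace ℂ H]

/-- The vectors `v x` resolve the identity: `∫ |v x⟩⟨v x| dν(x) = 1` in the weak sense, that is,
`φ ↦ ⟨v ·, φ⟩` is an isometry into `L²(ν)`. -/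
structure ResolvesIdentity (ν : Measure X) (v : X → H) : Prop where
  measurable_inner : ∀ φ, Measurable fun x => inner ℂ (v x) φ
  eLpNorm_inner : ∀ φ, eLpNorm (fun x => inner ℂ (v x) φ) 2 ν = ‖φ‖ₑ

lemma lintegral_enorm_sq_eq {E : Type*} [NormedAddCommGroup E] {ν : Measure X} (f : X → E) :
    ∫⁻ x, ‖f x‖ₑ ^ 2 ∂ν = eLpNorm f 2 ν ^ 2 := by
  have := eLpNorm_nnreal_pow_eq_lintegral (μ := ν) (f := f) (p := 2) (by norm_num)
  simpa using this.symm

lemma ResolvesIdentity.lintegral_enorm_inner_sq {ν : Measure X} {v : X → H}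
    (h : ResolvesIdentity ν v) (φ : H) : ∫⁻ x, ‖inner ℂ (v x) φ‖ₑ ^ 2 ∂ν = ‖φ‖ₑ ^ 2 := by
  rw [lintegral_enorm_sq_eq, h.eLpNorm_inner]

lemma resolvesIdentity_of_lintegral {ν : Measure X} {v : X → H}
    (hm : ∀ φ, Measurable fun x => inner ℂ (v x) φ)
    (h : ∀ φ, ∫⁻ x, ‖inner ℂ (v x) φ‖ₑ ^ 2 ∂ν = ‖φ‖ₑ ^ 2) : ResolvesIdentity ν v where
  measurable_inner := hm
  eLpNorm_inner φ := by
    have := h φ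
    rw [lintegral_enorm_sq_eq] at this
    exact (ENNReal.pow_right_strictMono two_ne_zero).injective this

/-- The sesquilinear identity extends from a set to its span. -/
lemma integrable_and_integral_inner_of_mem_span {ν : Measure X} {v : X → H} {S : Set H}
    (hS : ∀ a ∈ S, ∀ b ∈ S, Integrable (fun x => inner ℂ a (v x) * inner ℂ (v x) b) ν ∧
      ∫ x, inner ℂ a (v x) * inner ℂ (v x) b ∂ν = inner ℂ a b)
    {a b : H} (ha : a ∈ Submodule.span ℂ S) (hb : b ∈ Submodule.span ℂ S) :
    Integrable (fun x => inner ℂ a (v x) * inner ℂ (v x) b) ν ∧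
      ∫ x, inner ℂ a (v x) * inner ℂ (v x) b ∂ν = inner ℂ a b := by
  induction hb using Submodule.span_induction with
  | mem b hb =>
    induction ha using Submodule.span_induction with
    | mem a ha => exact hS a ha b hb
    | zero => simp
    | add a a' _ _ h h' =>
      simp only [inner_add_left, add_mul]
      exact ⟨h.1.add h'.1, by rw [integral_add h.1 h'.1, h.2, h'.2]⟩
    | smul c a _ h =>
      simp only [inner_smul_left, mul_assoc]
      exact ⟨h.1.const_mul _, by rw [integral_const_mul, h.2]⟩
  | zero => simp
  | add b b' _ _ h h' =>
    simp only [inner_add_right, mul_add]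
    exact ⟨h.1.add h'.1, by rw [integral_add h.1 h'.1, h.2, h'.2]⟩
  | smul c b _ h =>
    simp only [inner_smul_right, mul_left_comm _ c]
    exact ⟨h.1.const_mul _, by rw [integral_const_mul, h.2]⟩

lemma inner_mul_inner_self (a u : H) :
    inner ℂ a u * inner ℂ u a = ((‖inner ℂ u a‖ ^ 2 : ℝ) : ℂ) := by
  rw [← inner_conj_symm a u, mul_comm, Complex.mul_conj, Complex.normSq_eq_norm_sq]

/-- A resolution of the identity may be checked on a total set: Fatou's lemma gives one inequality
for all vectors, and the triangle inequality in `L²` then gives the other. -/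
theorem ResolvesIdentity.of_span_dense {ν : Measure X} {v : X → H} {S : Set H}
    (hm : ∀ φ, Measurable fun x => inner ℂ (v x) φ)
    (hd : (Submodule.span ℂ S).topologicalClosure = ⊤)
    (hS : ∀ a ∈ S, ∀ b ∈ S, Integrable (fun x => inner ℂ a (v x) * inner ℂ (v x) b) ν ∧
      ∫ x, inner ℂ a (v x) * inner ℂ (v x) b ∂ν = inner ℂ a b) :
    ResolvesIdentity ν v := by
  have hK : ∀ a ∈ Submodule.span ℂ S, eLpNorm (fun x => inner ℂ (v x) a) 2 ν = ‖a‖ₑ := by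
    intro a ha
    obtain ⟨h1, h2⟩ := integrable_and_integral_inner_of_mem_span hS ha ha
    simp only [inner_mul_inner_self] at h1 h2
    have h1' : Integrable (fun x => ‖inner ℂ (v x) a‖ ^ 2) ν := by
      exact h1.re
    rw [integral_complex_ofReal, inner_self_eq_norm_sq_to_K] at h2
    have h3 : ∫ x, ‖inner ℂ (v x) a‖ ^ 2 ∂ν = ‖a‖ ^ 2 :=
      Complex.ofReal_injective (h2.trans (by push_cast; rfl))
    have h4 : ∫⁻ x, ‖inner ℂ (v x) a‖ₑ ^ 2 ∂ν = ‖a‖ₑ ^ 2 := by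
      have := ofReal_integral_eq_lintegral_ofReal h1'
        (Filter.Eventually.of_forall fun x => by positivity)
      rw [h3] at this
      simpa [ENNReal.ofReal_pow, ofReal_norm] using this.symm
    rw [lintegral_enorm_sq_eq] at h4
    exact (ENNReal.pow_right_strictMono two_ne_zero).injective h4
  have hseq : ∀ φ : H, ∃ u : ℕ → H, (∀ n, u n ∈ Submodule.span ℂ S) ∧
      Filter.Tendsto u Filter.atTop (nhds φ) := by
    intro φ
    have : φ ∈ closure ((Submodule.span ℂ S : Submodule ℂ H) : Set H) := by
      rw [← Submodule.topologicalClosure_coe, hd]; trivial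
    exact mem_closure_iff_seq_limit.1 this
  have hle : ∀ φ, eLpNorm (fun x => inner ℂ (v x) φ) 2 ν ≤ ‖φ‖ₑ := by
    intro φ
    obtain ⟨u, hu, hlim⟩ := hseq φ
    refine (Lp.eLpNorm_lim_le_liminf_eLpNorm (f := fun n x => inner ℂ (v x) (u n))
      (fun n => (hm _).aestronglyMeasurable) _
      (Filter.Eventually.of_forall fun x => tendsto_const_nhds.inner hlim)).trans (le_of_eq ?_)
    simp only [hK _ (hu _)]
    exact (hlim.enorm).liminf_eq
  refine ⟨hm, fun φ => le_antisymm (hle φ) ?_⟩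
  obtain ⟨u, hu, hlim⟩ := hseq φ
  have h1 : ∀ n, ‖u n‖ₑ ≤ eLpNorm (fun x => inner ℂ (v x) φ) 2 ν + ‖u n - φ‖ₑ := by
    intro n
    rw [← hK _ (hu n)]
    have : (fun x => inner ℂ (v x) (u n)) =
        (fun x => inner ℂ (v x) φ) + fun x => inner ℂ (v x) (u n - φ) := by
      ext x; simp
    rw [this]
    exact (eLpNorm_add_le (hm _).aestronglyMeasurable (hm _).aestronglyMeasurable
      (by norm_num)).trans (by gcongr; exact hle _)
  have h2 : Filter.Tendsto (fun n => eLpNorm (fun x => inner ℂ (v x) φ) 2 ν + ‖u n - φ‖ₑ)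
      Filter.atTop (nhds (eLpNorm (fun x => inner ℂ (v x) φ) 2 ν + 0)) := by
    have := (hlim.sub_const φ).enorm
    rw [sub_self, enorm_zero] at this
    exact this.const_add _
  rw [add_zero] at h2
  exact le_of_tendsto_of_tendsto' hlim.enorm h2 h1

variable {ν : Measure X} {v : X → H}

lemma ResolvesIdentity.memLp_inner (h : ResolvesIdentity ν v) (φ : H) :
    MemLp (fun x => inner ℂ (v x) φ) 2 ν :=
  ⟨(h.measurable_inner φ).aestronglyMeasurable, by rw [h.eLpNorm_inner]; exact enorm_lt_top⟩

/-- The isometry `φ ↦ ⟨v ·, φ⟩` into `L²(ν)`. -/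
def ResolvesIdentity.toL2 (h : ResolvesIdentity ν v) : H →ₗᵢ[ℂ] Lp ℂ 2 ν where
  toFun φ := (h.memLp_inner φ).toLp _
  map_add' φ ψ := by
    rw [← MemLp.toLp_add]
    exact MemLp.toLp_congr _ _ (Filter.Eventually.of_forall fun x => by simp)
  map_smul' c φ := by
    rw [RingHom.id_apply, ← MemLp.toLp_const_smul]
    exact MemLp.toLp_congr _ _ (Filter.Eventually.of_forall fun x => by simp)
  norm_map' φ := by
    change ‖(h.memLp_inner φ).toLp _‖ = _
    rw [Lp.norm_toLp, h.eLpNorm_inner, toReal_enorm]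

lemma ResolvesIdentity.integrable_inner_mul_inner (h : ResolvesIdentity ν v) (φ ψ : H) :
    Integrable (fun x => inner ℂ φ (v x) * inner ℂ (v x) ψ) ν := by
  have := (h.memLp_inner φ).star.integrable_mul (h.memLp_inner ψ)
  refine this.congr (Filter.Eventually.of_forall fun x => ?_)
  simp

/-- Polarization of the resolution of the identity. -/
lemma ResolvesIdentity.integral_inner_mul_inner (h : ResolvesIdentity ν v) (φ ψ : H) :
    ∫ x, inner ℂ φ (v x) * inner ℂ (v x) ψ ∂ν = inner ℂ φ ψ := by
  rw [← h.toL2.inner_map_map φ ψ, L2.inner_def]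
  refine integral_congr_ae ?_
  filter_upwards [(h.memLp_inner φ).coeFn_toLp, (h.memLp_inner ψ).coeFn_toLp] with x h1 h2
  change _ = inner ℂ (((h.memLp_inner φ).toLp _ : Lp ℂ 2 ν) x)
    (((h.memLp_inner ψ).toLp _ : Lp ℂ 2 ν) x)
  rw [h1, h2]
  simp [mul_comm]

/-- Vectors that resolve the identity are total. -/
lemma ResolvesIdentity.eq_zero (h : ResolvesIdentity ν v) {φ : H}
    (hφ : ∀ x, inner ℂ (v x) φ = 0) : φ = 0 := by
  have := h.eLpNorm_inner φ
  simp only [hφ] at this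
  exact enorm_eq_zero.1 (this.symm.trans eLpNorm_zero)

end ResolvesIdentity

/-! ### The Fock basis, and the trace of a density operator -/

lemma inner_fockState {m : ℕ} (k : Fin m → ℕ) (φ : FockSpace m) :
    inner ℂ (fockState k) φ = φ k := by
  rw [fockState, lp.inner_single_left]; simp

lemma fockState_apply {m : ℕ} (k l : Fin m → ℕ) :
    fockState k l = if l = k then 1 else 0 := by
  rw [fockState, lp.single_apply]
  split_ifs with h
  · subst h; simp
  · simp [h]

lemma tsum_enorm_apply_sq {ι : Type*} (φ : lp (fun _ : ι => ℂ) 2) :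
    ∑' k, ‖φ k‖ₑ ^ 2 = ‖φ‖ₑ ^ 2 := by
  have h := lp.hasSum_norm (p := 2) (by norm_num) φ
  simp only [ENNReal.toReal_ofNat, Real.rpow_ofNat] at h
  have h2 := ENNReal.ofReal_tsum_of_nonneg (fun k => by positivity) h.summable
  rw [h.tsum_eq] at h2
  simpa [ENNReal.ofReal_pow, ofReal_norm] using h2.symm

/-- Photon counting: the Fock basis resolves the identity. -/
lemma resolvesIdentity_fockState (m : ℕ) :
    ResolvesIdentity (Measure.count : Measure (Fin m → ℕ)) fockState := by
  refine resolvesIdentity_of_lintegral (fun φ => measurable_of_countable _) fun φ => ?_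
  · rw [lintegral_count]
    simp only [inner_fockState]
    exact tsum_enorm_apply_sq φ

/-- The weight `⟨u|ρ|u⟩` of a vector `u` in the state `ρ`. -/
def weight {m : ℕ} (ρ : FockSpace m →L[ℂ] FockSpace m) (u : FockSpace m) : ℝ :=
  (inner ℂ u (ρ u)).re

lemma IsDensity.weight_nonneg {m : ℕ} {ρ : FockSpace m →L[ℂ] FockSpace m} (hρ : IsDensity ρ)
    (u : FockSpace m) : 0 ≤ weight ρ u := by
  have := hρ.1.inner_nonneg_right u
  exact (Complex.nonneg_iff.1 this).1

/-- The square root of a positive operator. -/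
lemma exists_sqrt_of_isPositive {H : Type*} [NormedAddCommGroup H] [InnerProductSpace ℂ H]
    [CompleteSpace H] {ρ : H →L[ℂ] H} (hρ : ρ.IsPositive) :
    ∃ B : H →L[ℂ] H, (∀ u w, inner ℂ (B u) w = inner ℂ u (B w)) ∧ ∀ u, ρ u = B (B u) := by
  have h0 : 0 ≤ ρ := (ContinuousLinearMap.nonneg_iff_isPositive ρ).2 hρ
  have hB := (ContinuousLinearMap.nonneg_iff_isPositive _).1 (CFC.sqrt_nonneg ρ)
  refine ⟨CFC.sqrt ρ, fun u w => hB.isSymmetric u w, fun u => ?_⟩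
  conv_lhs => rw [← CFC.sqrt_mul_sqrt_self ρ h0]
  rfl

section sqrt

variable {m : ℕ} {ρ B : FockSpace m →L[ℂ] FockSpace m}

lemma weight_eq_norm_sq (hB : ∀ u w, inner ℂ (B u) w = inner ℂ u (B w))
    (hρB : ∀ u, ρ u = B (B u)) (u : FockSpace m) : weight ρ u = ‖B u‖ ^ 2 := by
  rw [weight, hρB, ← hB, inner_self_eq_norm_sq_to_K]
  norm_cast

/-- The weight of `u` is `∑ₖ |⟨√ρ k|u⟩|²`, a sum over pure states. -/
lemma ofReal_weight_eq_tsum (hB : ∀ u w, inner ℂ (B u) w = inner ℂ u (B w))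
    (hρB : ∀ u, ρ u = B (B u)) (u : FockSpace m) :
    ENNReal.ofReal (weight ρ u) = ∑' k, ‖inner ℂ u (B (fockState k))‖ₑ ^ 2 := by
  rw [weight_eq_norm_sq hB hρB, ENNReal.ofReal_pow (norm_nonneg _), ofReal_norm,
    ← tsum_enorm_apply_sq]
  refine tsum_congr fun k => ?_
  rw [← inner_fockState k (B u), ← hB, ← inner_conj_symm, RCLike.enorm_conj]

/-- The trace, computed in the Fock basis. -/
lemma IsDensity.tsum_enorm_sqrt_sq (hρ : IsDensity ρ)
    (hB : ∀ u w, inner ℂ (B u) w = inner ℂ u (B w)) (hρB : ∀ u, ρ u = B (B u)) :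
    ∑' k : Fin m → ℕ, ‖B (fockState k)‖ₑ ^ 2 = 1 := by
  have h : HasSum (fun k : Fin m → ℕ => weight ρ (fockState k)) 1 := by
    simpa [weight] using Complex.hasSum_re hρ.2
  have h2 := ENNReal.ofReal_tsum_of_nonneg (fun k => hρ.weight_nonneg (fockState k)) h.summable
  rw [h.tsum_eq, ENNReal.ofReal_one] at h2
  rw [h2]
  refine tsum_congr fun k => ?_
  rw [weight_eq_norm_sq hB hρB, ENNReal.ofReal_pow (norm_nonneg _), ofReal_norm]

end sqrt

section measurement

variable {X : Type*} [MeasurableSpace X] {m : ℕ} {ρ : FockSpace m →L[ℂ] FockSpace m}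
  {ν : Measure X} {v : X → FockSpace m}

lemma ResolvesIdentity.measurable_weight (h : ResolvesIdentity ν v) (hρ : IsDensity ρ) :
    Measurable fun x => weight ρ (v x) := by
  obtain ⟨B, hB, hρB⟩ := exists_sqrt_of_isPositive hρ.1
  have h1 : Measurable fun x => ENNReal.ofReal (weight ρ (v x)) := by
    simp only [ofReal_weight_eq_tsum hB hρB]
    exact Measurable.tsum fun k => (h.measurable_inner _).enorm.pow_const _
  have h2 := h1.ennreal_toReal
  simpa only [ENNReal.toReal_ofReal (hρ.weight_nonneg _)] using h2

/-- The trace of a density operator, computed with any resolution of the identity. -/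
lemma ResolvesIdentity.lintegral_weight (h : ResolvesIdentity ν v) (hρ : IsDensity ρ) :
    ∫⁻ x, ENNReal.ofReal (weight ρ (v x)) ∂ν = 1 := by
  obtain ⟨B, hB, hρB⟩ := exists_sqrt_of_isPositive hρ.1
  simp only [ofReal_weight_eq_tsum hB hρB]
  rw [lintegral_tsum fun k => ((h.measurable_inner _).enorm.pow_const _).aemeasurable,
    ← hρ.tsum_enorm_sqrt_sq hB hρB]
  exact tsum_congr fun k => h.lintegral_enorm_inner_sq _

/-- The distribution of the outcomes of the measurement of `ρ` with POVM elements `|v x⟩⟨v x|`. -/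
def outcome (ν : Measure X) (v : X → FockSpace m) (ρ : FockSpace m →L[ℂ] FockSpace m) :
    Measure X :=
  ν.withDensity fun x => ENNReal.ofReal (weight ρ (v x))

lemma ResolvesIdentity.isProbabilityMeasure_outcome (h : ResolvesIdentity ν v)
    (hρ : IsDensity ρ) : IsProbabilityMeasure (outcome ν v ρ) :=
  ⟨by rw [outcome, withDensity_apply _ MeasurableSet.univ, setLIntegral_univ,
    h.lintegral_weight hρ]⟩

end measurement

lemma isDensity_pureState {m : ℕ} {ψ : FockSpace m} (hψ : ‖ψ‖ = 1) : IsDensity (pureState ψ) := by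
  refine ⟨InnerProductSpace.isPositive_rankOne_self ψ, ?_⟩
  have h := lp.hasSum_inner (𝕜 := ℂ) ψ ψ
  rw [inner_self_eq_norm_sq_to_K, hψ] at h
  have h1 : ((1 : ℝ) : ℂ) ^ 2 = 1 := by simp
  have h2 : (fun k => inner ℂ (fockState k) ((pureState ψ) (fockState k))) =
      fun k => inner ℂ (ψ k) (ψ k) := by
    ext k
    rw [pureState, InnerProductSpace.rankOne_apply, inner_smul_right, inner_fockState,
      ← inner_conj_symm, inner_fockState, RCLike.inner_apply, mul_comm]
  rw [h2, ← h1]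
  exact h

lemma weight_pureState {m : ℕ} (ψ u : FockSpace m) :
    weight (pureState ψ) u = ‖inner ℂ u ψ‖ ^ 2 := by
  rw [weight, pureState, InnerProductSpace.rankOne_apply, inner_smul_right, mul_comm, mul_comm,
    inner_mul_inner_self, Complex.ofReal_re, ← inner_conj_symm, RCLike.norm_conj]

/-! ### Total variation distance and classical fidelity -/

section tv

variable {Y : Type*} [MeasurableSpace Y] {ν : Measure Y} {f g : Y → ℝ}

/-- Probability measures with densities `f²` and `g²` have total variation distance at most
`√(1 - (∫ f g)²)`, by the Cauchy-Schwarz inequality for `f² - g² = (f - g) (f + g)`. -/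
lemma abs_withDensity_sub_le (hf : MemLp f 2 ν) (hg : MemLp g 2 ν)
    (hf1 : ∫ y, f y ^ 2 ∂ν = 1) (hg1 : ∫ y, g y ^ 2 ∂ν = 1)
    {A : Set Y} (hA : MeasurableSet A) :
    |(ν.withDensity fun y => ENNReal.ofReal (f y ^ 2)).real A -
      (ν.withDensity fun y => ENNReal.ofReal (g y ^ 2)).real A| ≤
      Real.sqrt (1 - (∫ y, f y * g y ∂ν) ^ 2) := by
  have hf2 : Integrable (fun y => f y ^ 2) ν := hf.integrable_sq
  have hg2 : Integrable (fun y => g y ^ 2) ν := hg.integrable_sq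
  have hfg : Integrable (fun y => f y * g y) ν := hf.integrable_mul hg
  have hreal : ∀ (k : Y → ℝ) (_ : Integrable (fun y => k y ^ 2) ν) (s : Set Y),
      MeasurableSet s → (ν.withDensity fun y => ENNReal.ofReal (k y ^ 2)).real s =
        ∫ y in s, k y ^ 2 ∂ν := by
    intro k hk s hs
    rw [measureReal_def, withDensity_apply _ hs,
      ← ofReal_integral_eq_lintegral_ofReal hk.integrableOn
        (Filter.Eventually.of_forall fun y => by positivity),
      ENNReal.toReal_ofReal (integral_nonneg fun y => by positivity)]
  rw [hreal f hf2 A hA, hreal g hg2 A hA]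
  set D := ∫ y in A, f y ^ 2 ∂ν - ∫ y in A, g y ^ 2 ∂ν
  set b := ∫ y, f y * g y ∂ν
  have hdiff : Integrable (fun y => f y ^ 2 - g y ^ 2) ν := hf2.sub hg2
  have hAD : D = ∫ y in A, (f y ^ 2 - g y ^ 2) ∂ν :=
    (integral_sub hf2.integrableOn hg2.integrableOn).symm
  have hAc : ∫ y in Aᶜ, (f y ^ 2 - g y ^ 2) ∂ν = -D := by
    have h := integral_add_compl hA hdiff
    rw [← hAD, integral_sub hf2 hg2, hf1, hg1] at h
    linarith
  -- `f² - g²` has opposite integrals over `A` and its complement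
  have h2D : 2 * |D| ≤ ∫ y, |f y - g y| * |f y + g y| ∂ν := by
    have h := integral_add_compl hA hdiff.abs
    have h1 : |D| ≤ ∫ y in A, |f y ^ 2 - g y ^ 2| ∂ν := by
      rw [hAD]; exact abs_integral_le_integral_abs
    have h2 : |D| ≤ ∫ y in Aᶜ, |f y ^ 2 - g y ^ 2| ∂ν := by
      rw [← abs_neg, ← hAc]; exact abs_integral_le_integral_abs
    have h3 : ∀ y, |f y - g y| * |f y + g y| = |f y ^ 2 - g y ^ 2| := fun y => by
      rw [← abs_mul]; congr 1; ring
    simp only [h3]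
    linarith
  have hsum : Integrable (fun y => f y ^ 2 + g y ^ 2) ν := hf2.add hg2
  have hm2 : ∫ y, |f y - g y| ^ 2 ∂ν = 2 - 2 * b := by
    have : ∀ y, |f y - g y| ^ 2 = f y ^ 2 + g y ^ 2 - 2 * (f y * g y) := fun y => by
      rw [sq_abs]; ring
    simp only [this]
    rw [integral_sub hsum (hfg.const_mul 2), integral_add hf2 hg2, integral_const_mul,
      hf1, hg1]
    ring
  have hp2 : ∫ y, |f y + g y| ^ 2 ∂ν = 2 + 2 * b := by
    have : ∀ y, |f y + g y| ^ 2 = f y ^ 2 + g y ^ 2 + 2 * (f y * g y) := fun y => by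
      rw [sq_abs]; ring
    simp only [this]
    rw [integral_add hsum (hfg.const_mul 2), integral_add hf2 hg2, integral_const_mul,
      hf1, hg1]
    ring
  have hCS := integral_mul_le_Lp_mul_Lq_of_nonneg (μ := ν) Real.HolderConjugate.two_two
    (f := fun y => |f y - g y|) (g := fun y => |f y + g y|)
    (Filter.Eventually.of_forall fun y => abs_nonneg _)
    (Filter.Eventually.of_forall fun y => abs_nonneg _)
    (by rw [ENNReal.ofReal_ofNat]; exact (hf.sub hg).abs)
    (by rw [ENNReal.ofReal_ofNat]; exact (hf.add hg).abs)
  simp only [Real.rpow_two, hm2, hp2, ← Real.sqrt_eq_rpow] at hCS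
  have hm0 : 0 ≤ 2 - 2 * b := hm2 ▸ integral_nonneg fun y => by positivity
  rw [← Real.sqrt_mul hm0, show (2 - 2 * b) * (2 + 2 * b) = 2 ^ 2 * (1 - b ^ 2) by ring,
    Real.sqrt_mul (by norm_num), Real.sqrt_sq (by norm_num)] at hCS
  linarith

/-- Independent samples from a density have the product density. -/
lemma pi_withDensity_sq [SigmaFinite ν] (hf2 : Integrable (fun y => f y ^ 2) ν)
    (M : ℕ) :
    (Measure.pi fun _ : Fin M => ν.withDensity fun y => ENNReal.ofReal (f y ^ 2)) =
      (Measure.pi fun _ : Fin M => ν).withDensity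
        fun x => ENNReal.ofReal ((∏ i, f (x i)) ^ 2) := by
  have : IsFiniteMeasure (ν.withDensity fun y => ENNReal.ofReal (f y ^ 2)) :=
    isFiniteMeasure_withDensity_ofReal hf2.2
  refine Measure.pi_eq fun s hs => ?_
  have hind : ∀ i, Integrable (fun y => (s i).indicator (fun y => f y ^ 2) y) ν :=
    fun i => hf2.indicator (hs i)
  have hprod : ∀ x : Fin M → Y, (Set.univ.pi s).indicator (fun x => (∏ i, f (x i)) ^ 2) x =
      ∏ i, (s i).indicator (fun y => f y ^ 2) (x i) := by
    intro x
    by_cases hx : x ∈ Set.univ.pi s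
    · rw [Set.indicator_of_mem hx, ← Finset.prod_pow]
      exact Finset.prod_congr rfl fun i _ =>
        (Set.indicator_of_mem (hx i trivial) (fun y => f y ^ 2)).symm
    · rw [Set.indicator_of_notMem hx]
      obtain ⟨i, hi⟩ : ∃ i, x i ∉ s i := by simpa [Set.mem_univ_pi] using hx
      exact (Finset.prod_eq_zero (Finset.mem_univ i) (Set.indicator_of_notMem hi _)).symm
  have hpi := MeasurableSet.univ_pi hs
  rw [withDensity_apply _ hpi, ← lintegral_indicator hpi]
  have h1 : ∀ x : Fin M → Y, (Set.univ.pi s).indicator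
      (fun x => ENNReal.ofReal ((∏ i, f (x i)) ^ 2)) x =
      ENNReal.ofReal (∏ i, (s i).indicator (fun y => f y ^ 2) (x i)) := by
    intro x
    rw [← hprod]
    by_cases hx : x ∈ Set.univ.pi s <;> simp [hx]
  have hnn : ∀ i y, 0 ≤ (s i).indicator (fun y => f y ^ 2) y := fun i y =>
    Set.indicator_nonneg (fun _ _ => by positivity) _
  simp only [h1]
  rw [← ofReal_integral_eq_lintegral_ofReal (Integrable.fintype_prod hind)
    (Filter.Eventually.of_forall fun x => Finset.prod_nonneg fun i _ => hnn i _),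
    integral_fintype_prod_eq_prod (fun i y => (s i).indicator (fun y => f y ^ 2) y),
    ENNReal.ofReal_prod_of_nonneg fun i _ => integral_nonneg fun y => hnn i y]
  refine Finset.prod_congr rfl fun i _ => ?_
  rw [withDensity_apply _ (hs i), integral_indicator (hs i),
    ofReal_integral_eq_lintegral_ofReal hf2.integrableOn
      (Filter.Eventually.of_forall fun y => by positivity)]

/-- The total variation bound for independent samples. The overlap `∫ f g` is multiplicative. -/
lemma tvDist_iid_withDensity_le [SigmaFinite ν] (hf : MemLp f 2 ν) (hg : MemLp g 2 ν)
    (hf1 : ∫ y, f y ^ 2 ∂ν = 1) (hg1 : ∫ y, g y ^ 2 ∂ν = 1) (M : ℕ) :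
    tvDist (iid M (ν.withDensity fun y => ENNReal.ofReal (f y ^ 2)))
      (iid M (ν.withDensity fun y => ENNReal.ofReal (g y ^ 2))) ≤
      Real.sqrt (1 - ((∫ y, f y * g y ∂ν) ^ M) ^ 2) := by
  have key : ∀ k : Y → ℝ, MemLp k 2 ν → (∫ y, k y ^ 2 ∂ν = 1) →
      MemLp (fun x : Fin M → Y => ∏ i, k (x i)) 2 (Measure.pi fun _ => ν) ∧
        ∫ x : Fin M → Y, (∏ i, k (x i)) ^ 2 ∂(Measure.pi fun _ => ν) = 1 := by
    intro k hk hk1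
    constructor
    · rw [memLp_two_iff_integrable_sq]
      · simp only [← Finset.prod_pow]
        exact Integrable.fintype_prod fun _ => hk.integrable_sq
      · exact Finset.aestronglyMeasurable_fun_prod _ fun i _ =>
          hk.1.comp_quasiMeasurePreserving (Measure.quasiMeasurePreserving_eval _ i)
    · simp only [← Finset.prod_pow]
      rw [integral_fintype_prod_eq_pow (fun y => k y ^ 2), hk1, one_pow]
  rw [iid, iid, pi_withDensity_sq hf.integrable_sq, pi_withDensity_sq hg.integrable_sq]
  refine Real.iSup_le (fun A => ?_) (Real.sqrt_nonneg _)
  have h := abs_withDensity_sub_le (key f hf hf1).1 (key g hg hg1).1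
    (key f hf hf1).2 (key g hg hg1).2 A.2
  simp only [← Finset.prod_mul_distrib] at h
  rwa [integral_fintype_prod_eq_pow (fun y => f y * g y), Fintype.card_fin] at h

end tv

/-! ### Measurements of a state of high fidelity -/

section measurement

variable {X : Type*} [MeasurableSpace X] {m : ℕ} {ρ : FockSpace m →L[ℂ] FockSpace m}
  {ψ : FockSpace m} {ν : Measure X} {v : X → FockSpace m}

/-- Measuring does not decrease the fidelity: the classical fidelity (Bhattacharyya coefficient) of
the outcome distributions is at least `√⟨ψ|ρ|ψ⟩`. -/
lemma ResolvesIdentity.sqrt_weight_le_integral (h : ResolvesIdentity ν v) (hρ : IsDensity ρ)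
    (ψ : FockSpace m)
    (hint : Integrable (fun x => Real.sqrt (weight ρ (v x)) * ‖inner ℂ (v x) ψ‖) ν) :
    Real.sqrt (weight ρ ψ) ≤ ∫ x, Real.sqrt (weight ρ (v x)) * ‖inner ℂ (v x) ψ‖ ∂ν := by
  obtain ⟨B, hB, hρB⟩ := exists_sqrt_of_isPositive hρ.1
  have hs : ∀ u, Real.sqrt (weight ρ u) = ‖B u‖ := fun u => by
    rw [weight_eq_norm_sq hB hρB, Real.sqrt_sq (norm_nonneg _)]
  simp only [hs] at hint ⊢
  have h1 : ‖B ψ‖ ^ 2 = ‖∫ x, inner ℂ (ρ ψ) (v x) * inner ℂ (v x) ψ ∂ν‖ := by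
    rw [h.integral_inner_mul_inner, hρB, hB, inner_self_eq_norm_sq_to_K]
    simp
  have h2 : ‖B ψ‖ ^ 2 ≤ ‖B ψ‖ * ∫ x, ‖B (v x)‖ * ‖inner ℂ (v x) ψ‖ ∂ν := by
    rw [h1, ← integral_const_mul]
    refine (norm_integral_le_integral_norm _).trans (integral_mono
      (h.integrable_inner_mul_inner _ _).norm (hint.const_mul _) fun x => ?_)
    simp only [norm_mul]
    rw [← mul_assoc, hρB, hB]
    gcongr
    exact norm_inner_le_norm _ _
  rcases (norm_nonneg (B ψ)).eq_or_lt with h0 | h0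
  · rw [← h0]; exact integral_nonneg fun x => by positivity
  · rw [sq] at h2
    exact le_of_mul_le_mul_left h2 h0

/-- Samples from `M` copies of `ρ` and of the pure state `ψ` are at total variation distance at most
`√(1 - F^M)`, where `F = ⟨ψ|ρ|ψ⟩` is the fidelity. -/
theorem ResolvesIdentity.tvDist_iid_outcome_le [SigmaFinite ν] (h : ResolvesIdentity ν v)
    (hρ : IsDensity ρ) (hψ : ‖ψ‖ = 1) (M : ℕ) :
    tvDist (iid M (outcome ν v ρ)) (iid M (outcome ν v (pureState ψ))) ≤
      Real.sqrt (1 - weight ρ ψ ^ M) := by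
  set f := fun x => Real.sqrt (weight ρ (v x))
  set g := fun x => ‖inner ℂ (v x) ψ‖
  have hf2 : ∀ x, f x ^ 2 = weight ρ (v x) := fun x => Real.sq_sqrt (hρ.weight_nonneg _)
  have hw : Integrable (fun x => weight ρ (v x)) ν := by
    refine ⟨(h.measurable_weight hρ).aestronglyMeasurable, ?_⟩
    rw [hasFiniteIntegral_iff_ofReal (Filter.Eventually.of_forall fun x => hρ.weight_nonneg _),
      h.lintegral_weight hρ]
    exact ENNReal.one_lt_top
  have hfL : MemLp f 2 ν := by
    rw [memLp_two_iff_integrable_sq (h.measurable_weight hρ).sqrt.aestronglyMeasurable]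
    exact hw.congr (Filter.Eventually.of_forall fun x => (hf2 x).symm)
  have hgL : MemLp g 2 ν := (h.memLp_inner ψ).norm
  have hf1 : ∫ x, f x ^ 2 ∂ν = 1 := by
    simp only [hf2]
    rw [integral_eq_lintegral_of_nonneg_ae
      (Filter.Eventually.of_forall fun x => hρ.weight_nonneg _) hw.1, h.lintegral_weight hρ]
    simp
  have hg1 : ∫ x, g x ^ 2 ∂ν = 1 := by
    have h1 := h.integral_inner_mul_inner ψ ψ
    simp only [inner_mul_inner_self] at h1
    rw [integral_complex_ofReal, inner_self_eq_norm_sq_to_K, hψ] at h1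
    exact Complex.ofReal_injective (h1.trans (by simp))
  have h1 := tvDist_iid_withDensity_le hfL hgL hf1 hg1 M
  have hof : outcome ν v ρ = ν.withDensity fun x => ENNReal.ofReal (f x ^ 2) := by
    simp only [hf2]; rfl
  have hog : outcome ν v (pureState ψ) = ν.withDensity fun x => ENNReal.ofReal (g x ^ 2) := by
    simp only [outcome, weight_pureState]; rfl
  rw [hof, hog]
  refine h1.trans (Real.sqrt_le_sqrt ?_)
  have h2 := h.sqrt_weight_le_integral hρ ψ (hfL.integrable_mul hgL)
  have h3 : weight ρ ψ ^ M = (Real.sqrt (weight ρ ψ) ^ M) ^ 2 := by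
    rw [← pow_mul, mul_comm, pow_mul, Real.sq_sqrt (hρ.weight_nonneg _)]
  rw [h3]
  gcongr

end measurement

lemma tvDist_map_le {Ω Ω' : Type*} [MeasurableSpace Ω] [MeasurableSpace Ω'] {P Q : Measure Ω}
    [IsFiniteMeasure P] [IsFiniteMeasure Q] {T : Ω → Ω'} (hT : Measurable T) :
    tvDist (P.map T) (Q.map T) ≤ tvDist P Q := by
  have hbdd : BddAbove (Set.range fun A : {A : Set Ω // MeasurableSet A} =>
      |P.real A - Q.real A|) := by
    refine ⟨P.real Set.univ + Q.real Set.univ, ?_⟩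
    rintro _ ⟨A, rfl⟩
    have h1 := measureReal_mono (μ := P) (Set.subset_univ (A : Set Ω))
    have h2 := measureReal_mono (μ := Q) (Set.subset_univ (A : Set Ω))
    have h3 := measureReal_nonneg (μ := P) (s := (A : Set Ω))
    have h4 := measureReal_nonneg (μ := Q) (s := (A : Set Ω))
    exact abs_le.2 ⟨by linarith, by linarith⟩
  refine Real.iSup_le (fun A => ?_) (Real.iSup_nonneg fun _ => abs_nonneg _)
  rw [map_measureReal_apply hT A.2, map_measureReal_apply hT A.2]
  exact le_ciSup hbdd ⟨T ⁻¹' A, hT A.2⟩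

lemma tvDist_iid_map_le {Ω Ω' : Type*} [MeasurableSpace Ω] [MeasurableSpace Ω'] {P Q : Measure Ω}
    [IsProbabilityMeasure P] [IsProbabilityMeasure Q] {T : Ω → Ω'} (hT : Measurable T) (M : ℕ) :
    tvDist (iid M (P.map T)) (iid M (Q.map T)) ≤ tvDist (iid M P) (iid M Q) := by
  have : IsProbabilityMeasure (P.map T) := Measure.isProbabilityMeasure_map hT.aemeasurable
  have : IsProbabilityMeasure (Q.map T) := Measure.isProbabilityMeasure_map hT.aemeasurable
  simp only [iid]
  rw [← Measure.pi_map_pi fun _ => hT.aemeasurable, ← Measure.pi_map_pi fun _ => hT.aemeasurable]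
  exact tvDist_map_le (by fun_prop)

/-! ### Single-mode squeezed coherent states resolve the identity -/

lemma memℓp_two_of_summable_norm {f : ℕ → ℂ} (hf : Summable fun k => ‖f k‖) : Memℓp f 2 := by
  have h1 : Memℓp f 1 := memℓp_gen (by simpa using hf)
  exact h1.of_exponent_ge (by norm_num)

/-- The Hilbert space of a single mode. -/
abbrev ModeSpace : Type := lp (fun _ : ℕ => ℂ) 2

/-- The single-mode squeezed coherent state `|α, ξ⟩`. -/
def squeezedMode (ξ α : ℂ) : ModeSpace :=
  ⟨squeezedAmp α ξ, memℓp_two_of_summable_norm (summable_squeezedAmp α ξ)⟩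

lemma sum_range_half_eq_sum_antidiagonal (f : ℕ → ℕ → ℂ) (k : ℕ) :
    ∑ a ∈ Finset.range (k / 2 + 1), f a (k - 2 * a) =
      ∑ q ∈ Finset.HasAntidiagonal.antidiagonal k, if Even q.1 then f (q.1 / 2) q.2 else 0 := by
  rw [Finset.Nat.sum_antidiagonal_eq_sum_range_succ_mk, ← Finset.sum_filter]
  refine Finset.sum_nbij' (fun a => 2 * a) (fun b => b / 2) ?_ ?_ ?_ ?_ ?_
  · intro a ha
    have := Finset.mem_range.1 ha
    simp only [Finset.mem_filter, Finset.mem_range]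
    exact ⟨by omega, even_two_mul a⟩
  · intro b hb
    simp only [Finset.mem_filter, Finset.mem_range] at hb ⊢
    omega
  · intro a _; simp
  · intro b hb
    simp only [Finset.mem_filter, Finset.mem_range] at hb
    obtain ⟨r, hr⟩ := hb.2
    omega
  · intro a _; simp

/-- The exponential generating function of the coefficients of `exp(x s² + y s)`. -/
lemma hasSum_exp_mul_exp (x y : ℂ) :
    HasSum (fun k : ℕ => ∑ a ∈ Finset.range (k / 2 + 1),
      x ^ a / (a.factorial : ℂ) * (y ^ (k - 2 * a) / ((k - 2 * a).factorial : ℂ)))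
      (Complex.exp x * Complex.exp y) := by
  -- the coefficients of `exp(x s²)`; the claim is a Cauchy product
  set A : ℕ → ℂ := fun n => if Even n then x ^ (n / 2) / ((n / 2).factorial : ℂ) else 0 with hA
  set E : ℕ → ℂ := fun n => y ^ n / (n.factorial : ℂ) with hE
  have hinj : Function.Injective fun a : ℕ => 2 * a := fun a b h => by
    simpa using h
  have hcomp : ∀ z : ℂ, (fun n => z ^ n / (n.factorial : ℂ)) =
      fun n => ((n.factorial : ℂ)⁻¹) • z ^ n := fun z => by
    ext n; rw [smul_eq_mul, div_eq_inv_mul]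
  have hexp : ∀ z : ℂ, HasSum (fun n : ℕ => z ^ n / (n.factorial : ℂ)) (Complex.exp z) := by
    intro z
    rw [hcomp, Complex.exp_eq_exp_ℂ]
    exact NormedSpace.exp_series_hasSum_exp' z
  have hout : ∀ n ∉ Set.range (fun a : ℕ => 2 * a), A n = 0 := by
    intro n hn
    refine if_neg fun h => hn ?_
    obtain ⟨r, hr⟩ := h
    exact ⟨r, by simp only; omega⟩
  have hAcomp : A ∘ (fun a : ℕ => 2 * a) = fun n => x ^ n / (n.factorial : ℂ) := by
    ext a; simp [hA]
  have hAs : HasSum A (Complex.exp x) := by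
    rw [← hinj.hasSum_iff hout, hAcomp]; exact hexp x
  have hAn : Summable fun n => ‖A n‖ := by
    have h1 : Summable ((fun n => ‖A n‖) ∘ fun a : ℕ => 2 * a) := by
      have : ((fun n => ‖A n‖) ∘ fun a : ℕ => 2 * a) = fun n => ‖x ^ n / (n.factorial : ℂ)‖ := by
        rw [← funext_iff.2 (fun n => congrArg norm (congrFun hAcomp n))]; rfl
      rw [this]; exact (hexp x).summable.norm
    exact (hinj.summable_iff fun n hn => by simp [hout n hn]).1 h1
  have hEn : Summable fun n => ‖E n‖ := (hexp y).summable.norm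
  have hsum := (summable_norm_sum_mul_antidiagonal_of_summable_norm hAn hEn).of_norm.hasSum
  rw [← tsum_mul_tsum_eq_tsum_sum_antidiagonal_of_summable_norm hAn hEn, hAs.tsum_eq,
    (hexp y).tsum_eq] at hsum
  refine (congrArg (fun F => HasSum F (Complex.exp x * Complex.exp y))
    (funext fun k => ?_)).mpr hsum
  rw [sum_range_half_eq_sum_antidiagonal
    (fun a b => x ^ a / (a.factorial : ℂ) * (y ^ b / (b.factorial : ℂ)))]
  refine Finset.sum_congr rfl fun q _ => ?_
  simp only [hA, hE]
  split_ifs <;> simp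

/-- The value at `x` of the generating function `∑ₖ ⟨k|α, ξ⟩ x^k / √(k!)`. -/
def squeezedGen (ξ α : ℂ) (x : ℝ) : ℂ :=
  ((Real.sqrt (Real.cosh ‖ξ‖))⁻¹ : ℝ) *
    Complex.exp (-(‖α‖ ^ 2 / 2 : ℝ) + star (squeezeTanh ξ) * α ^ 2 / 2) *
    (Complex.exp (-squeezeTanh ξ * x ^ 2 / 2) * Complex.exp (α / (Real.cosh ‖ξ‖ : ℝ) * x))

lemma hasSum_squeezedGen (ξ α : ℂ) (x : ℝ) :
    HasSum (fun k : ℕ => squeezedAmp α ξ k * ((x : ℂ) ^ k / (Real.sqrt k.factorial : ℝ)))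
      (squeezedGen ξ α x) := by
  have h := (hasSum_exp_mul_exp (-squeezeTanh ξ * x ^ 2 / 2)
    (α / (Real.cosh ‖ξ‖ : ℝ) * x)).mul_left
      (((Real.sqrt (Real.cosh ‖ξ‖))⁻¹ : ℝ) *
        Complex.exp (-(‖α‖ ^ 2 / 2 : ℝ) + star (squeezeTanh ξ) * α ^ 2 / 2))
  refine h.congr_fun ?_
  intro k
  have hk0 : ((Real.sqrt k.factorial : ℝ) : ℂ) ≠ 0 := by
    have : 0 < Real.sqrt k.factorial := Real.sqrt_pos.2 (by positivity)
    exact_mod_cast this.ne'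
  rw [squeezedAmp, mul_assoc]
  congr 1
  rw [mul_comm (Real.sqrt k.factorial : ℂ), mul_assoc, mul_div_cancel₀ _ hk0, Finset.sum_mul]
  refine Finset.sum_congr rfl fun a ha => ?_
  have hk : k = 2 * a + (k - 2 * a) := by
    have := Finset.mem_range.1 ha
    omega
  have hxk : (x : ℂ) ^ k = (x ^ 2) ^ a * x ^ (k - 2 * a) := by
    rw [← pow_mul, ← pow_add, ← hk]
  rw [hxk, mul_pow _ (x : ℂ),
    show -squeezeTanh ξ * (x : ℂ) ^ 2 / 2 = -squeezeTanh ξ / 2 * x ^ 2 by ring,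
    mul_pow _ ((x : ℂ) ^ 2)]
  ring

/-- The (unnormalized) coherent vector `∑ₖ x^k / √(k!) |k⟩`. -/
def expVec (x : ℝ) : ModeSpace :=
  ⟨fun k => (x : ℂ) ^ k / (Real.sqrt k.factorial : ℝ), by
    have h := (lp.memℓp (squeezedMode 0 x)).const_mul (Complex.exp (‖(x : ℂ)‖ ^ 2 / 2 : ℝ))
    refine (congrArg (fun f => Memℓp f 2) (funext fun k => ?_)).mp h
    change Complex.exp _ * squeezedAmp x 0 k = _
    rw [squeezedAmp_zero, coherentAmp, ← mul_div_assoc, ← mul_assoc, ← Complex.exp_add]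
    simp⟩

lemma inner_expVec_squeezedMode (ξ α : ℂ) (x : ℝ) :
    inner ℂ (expVec x) (squeezedMode ξ α) = squeezedGen ξ α x := by
  rw [← (hasSum_squeezedGen ξ α x).tsum_eq, ← (lp.hasSum_inner (𝕜 := ℂ) _ _).tsum_eq]
  refine tsum_congr fun k => ?_
  simp [expVec, squeezedMode]

lemma inner_expVec_expVec (x y : ℝ) : inner ℂ (expVec x) (expVec y) = Complex.exp (x * y) := by
  rw [← (lp.hasSum_inner (𝕜 := ℂ) _ _).tsum_eq, Complex.exp_eq_exp_ℂ,
    ← (NormedSpace.exp_series_hasSum_exp' (𝕂 := ℂ) ((x : ℂ) * y)).tsum_eq]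
  refine tsum_congr fun k => ?_
  have hk : (Real.sqrt k.factorial : ℝ) ^ 2 = (k.factorial : ℝ) := Real.sq_sqrt (by positivity)
  have hk' : ((Real.sqrt k.factorial : ℝ) : ℂ) ^ 2 = (k.factorial : ℂ) := by exact_mod_cast hk
  simp only [expVec, RCLike.inner_apply, map_div₀, map_pow, Complex.conj_ofReal, smul_eq_mul, ← hk']
  ring

/-- The coherent vectors with real parameter are total: a power series that vanishes on the
real line has zero coefficients. -/
lemma span_expVec_dense : (Submodule.span ℂ (Set.range expVec)).topologicalClosure = ⊤ := by
  rw [Submodule.topologicalClosure_eq_top_iff, Submodule.eq_bot_iff]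
  intro φ hφ
  have h0 : ∀ x : ℝ, HasSum (fun k : ℕ => x ^ k • (φ k / (Real.sqrt k.factorial : ℝ))) 0 := by
    intro x
    have h1 : inner ℂ (expVec x) φ = 0 := hφ _ (Submodule.subset_span ⟨x, rfl⟩)
    have h2 := lp.hasSum_inner (𝕜 := ℂ) (expVec x) φ
    rw [h1] at h2
    refine (congrArg (fun F => HasSum F (0 : ℂ)) (funext fun k => ?_)).mpr h2
    simp only [expVec, RCLike.inner_apply, map_div₀, map_pow, Complex.conj_ofReal,
      Complex.real_smul, Complex.ofReal_pow]
    ring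
  set p : FormalMultilinearSeries ℝ ℝ ℂ := fun k =>
    ContinuousMultilinearMap.mkPiRing ℝ (Fin k) (φ k / (Real.sqrt k.factorial : ℝ)) with hp
  have hc : ∀ k, p.coeff k = φ k / (Real.sqrt k.factorial : ℝ) := fun k => by
    simp [hp, FormalMultilinearSeries.coeff]
  have hser : HasFPowerSeriesAt (0 : ℝ → ℂ) p 0 := by
    rw [hasFPowerSeriesAt_iff]
    refine Filter.Eventually.of_forall fun x => ?_
    simp only [hc]
    exact h0 x
  have hp0 := hser.eq_zero
  ext k
  have := hc k
  rw [hp0] at this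
  have hk0 : ((Real.sqrt k.factorial : ℝ) : ℂ) ≠ 0 := by
    have : 0 < Real.sqrt k.factorial := Real.sqrt_pos.2 (by positivity)
    exact_mod_cast this.ne'
  have h3 : φ k / (Real.sqrt k.factorial : ℝ) = 0 := by
    rw [← this]; simp [FormalMultilinearSeries.coeff]
  simpa [hk0] using h3

/-- A Gaussian integral over the plane whose exponent separates. -/
lemma gaussian_integral_complex {A D : ℝ} (hA : 0 < A) (hD : 0 < D) (p q d : ℂ) :
    Integrable (fun β : ℂ => Complex.exp (-A * β.re ^ 2 + p * β.re + d) *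
        Complex.exp (-D * β.im ^ 2 + q * β.im + 0)) ∧
      ∫ β : ℂ, Complex.exp (-A * β.re ^ 2 + p * β.re + d) *
        Complex.exp (-D * β.im ^ 2 + q * β.im + 0) =
        (Real.pi / Real.sqrt (A * D) : ℝ) *
          Complex.exp (d + p ^ 2 / (4 * A) + q ^ 2 / (4 * D)) := by
  have hA' : (-(A : ℂ)).re < 0 := by simpa using hA
  have hD' : (-(D : ℂ)).re < 0 := by simpa using hD
  have h1 := integrable_cexp_quadratic' hA' p d
  have h2 := integrable_cexp_quadratic' hD' q 0
  have hmp := Complex.volume_preserving_equiv_real_prod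
  constructor
  · exact hmp.integrable_comp_of_integrable (h1.mul_prod h2)
  · have h3 := hmp.integral_comp' (fun z : ℝ × ℝ => Complex.exp (-A * z.1 ^ 2 + p * z.1 + d) *
        Complex.exp (-D * z.2 ^ 2 + q * z.2 + 0))
    refine h3.trans ?_
    rw [Measure.volume_eq_prod, integral_prod_mul
      (fun u : ℝ => Complex.exp (-A * u ^ 2 + p * u + d))
      (fun u : ℝ => Complex.exp (-D * u ^ 2 + q * u + 0)),
      integral_cexp_quadratic hA', integral_cexp_quadratic hD']
    have hcp : ∀ s : ℝ, 0 < s → ((Real.pi : ℂ) / - -(s : ℂ)) ^ (1 / 2 : ℂ) =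
        (Real.sqrt (Real.pi / s) : ℝ) := fun s hs => by
      rw [neg_neg, Real.sqrt_eq_rpow, Complex.ofReal_cpow (by positivity)]
      push_cast; rfl
    rw [hcp A hA, hcp D hD, mul_mul_mul_comm, ← Complex.exp_add, ← Complex.ofReal_mul,
      ← Real.sqrt_mul (by positivity)]
    congr 2
    · rw [div_mul_div_comm, Real.sqrt_div (by positivity), Real.sqrt_mul_self Real.pi_pos.le]
    · have : (A : ℂ) ≠ 0 := by exact_mod_cast hA.ne'
      have : (D : ℂ) ≠ 0 := by exact_mod_cast hD.ne'
      field_simp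
      ring

/-- The Gaussian integral behind the completeness of the squeezed coherent states. The phase of `ξ`
is removed by a rotation of the phase space. -/
lemma integral_squeezedGen (ξ : ℂ) (x y : ℝ) :
    Integrable (fun α : ℂ => squeezedGen ξ α x * star (squeezedGen ξ α y)) ∧
      ∫ α : ℂ, squeezedGen ξ α x * star (squeezedGen ξ α y) =
        Real.pi * Complex.exp (x * y) := by
  set c : ℝ := Real.cosh ‖ξ‖ with hc
  set s : ℝ := Real.tanh ‖ξ‖ with hs
  have hc0 : 0 < c := Real.cosh_pos _
  have hs2 : c ^ 2 * (1 - s ^ 2) = 1 := by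
    rw [hs, Real.tanh_eq_sinh_div_cosh, ← hc, div_pow]
    have := Real.cosh_sq_sub_sinh_sq ‖ξ‖
    rw [← hc] at this
    field_simp
    linarith
  have hs1 := abs_lt.1 (Real.abs_tanh_lt_one ‖ξ‖)
  rw [← hs] at hs1
  set w : ℂ := Complex.exp (((Complex.arg ξ / 2 : ℝ) : ℂ) * Complex.I) with hw
  have hw1 : ‖w‖ = 1 := Complex.norm_exp_ofReal_mul_I _
  have hww : w * star w = 1 := by
    rw [Complex.star_def, Complex.mul_conj, Complex.normSq_eq_norm_sq, hw1]; simp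
  have ht : squeezeTanh ξ = w ^ 2 * s := by
    rw [squeezeTanh, hw, ← Complex.exp_nat_mul]
    congr 2
    push_cast; ring
  have ht' : star (squeezeTanh ξ) = star w ^ 2 * s := by
    rw [ht]; simp
  set e : Circle := ⟨w, by simp [Submonoid.unitSphere, hw1]⟩
  have hrot : MeasurePreserving (rotation e) := (rotation e).measurePreserving
  -- with `α = w β`, the exponent separates into the real and the imaginary part of `β`
  set p : ℂ := (w * x + star w * y) / c with hp
  set q : ℂ := Complex.I * (w * x - star w * y) / c with hq
  set d : ℂ := -(s * (w ^ 2 * x ^ 2 + star w ^ 2 * y ^ 2) / 2) with hd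
  have key : ∀ β : ℂ, squeezedGen ξ (rotation e β) x * star (squeezedGen ξ (rotation e β) y) =
      (c⁻¹ : ℝ) * (Complex.exp (-(1 - s : ℝ) * β.re ^ 2 + p * β.re + d) *
        Complex.exp (-(1 + s : ℝ) * β.im ^ 2 + q * β.im + 0)) := by
    intro β
    have hβ : rotation e β = w * β := rfl
    have hcc : (((Real.sqrt c)⁻¹ : ℝ) : ℂ) * ((Real.sqrt c)⁻¹ : ℝ) = (c⁻¹ : ℝ) := by
      rw [← Complex.ofReal_mul, ← mul_inv, Real.mul_self_sqrt hc0.le]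
    have hstar : ∀ z, star (Complex.exp z) = Complex.exp (star z) := fun z =>
      (Complex.exp_conj z).symm
    have hsr : ∀ r : ℝ, star (r : ℂ) = r := Complex.conj_ofReal
    rw [hβ, squeezedGen, squeezedGen, ← hc, ht', ht, norm_mul, hw1, one_mul]
    simp only [star_mul', hstar, hsr]
    rw [show ∀ a b e1 e2 e3 f1 f2 f3 : ℂ, a * e1 * (e2 * e3) * (b * f1 * (f2 * f3)) =
      a * b * (e1 * e2 * e3 * f1 * f2 * f3) by intros; ring, hcc]
    congr 1
    simp only [← Complex.exp_add]
    congr 1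
    have hn : ((‖β‖ ^ 2 / 2 : ℝ) : ℂ) = (β.re ^ 2 + β.im ^ 2) / 2 := by
      rw [← Complex.normSq_eq_norm_sq, Complex.normSq_apply]; push_cast; ring
    have hb : β = β.re + β.im * Complex.I := (Complex.re_add_im β).symm
    have hbs : star β = β.re - β.im * Complex.I := by
      apply Complex.ext <;> simp
    have hI : Complex.I ^ 2 = -1 := Complex.I_sq
    simp only [star_add, star_neg, star_div₀, star_mul', star_pow, hsr, hn, star_star, star_ofNat]
    rw [show star w ^ 2 * (s : ℂ) * (w * β) ^ 2 = (w * star w) ^ 2 * (s * β ^ 2) by ring,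
      show w ^ 2 * (s : ℂ) * (star w * star β) ^ 2 = (w * star w) ^ 2 * (s * star β ^ 2) by ring,
      hww, hbs]
    rw [show β ^ 2 = (β.re + β.im * Complex.I) ^ 2 by rw [← hb],
      show w * β = w * (β.re + β.im * Complex.I) by rw [← hb]]
    rw [hp, hq, hd]
    push_cast
    linear_combination (s * (β.im : ℂ) ^ 2) * hI
  obtain ⟨hi, hv⟩ := gaussian_integral_complex (A := 1 - s) (D := 1 + s) (by linarith)
    (by linarith) p q d
  have hemb : MeasurableEmbedding (rotation e) := (rotation e).toHomeomorph.measurableEmbedding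
  constructor
  · rw [← hrot.integrable_comp_emb hemb]
    refine (hi.const_mul ((c⁻¹ : ℝ) : ℂ)).congr (Filter.Eventually.of_forall fun β => (key β).symm)
  · rw [← hrot.integral_comp hemb]
    simp only [key]
    rw [integral_const_mul, hv, ← mul_assoc, ← Complex.ofReal_mul]
    have hsq : Real.sqrt ((1 - s) * (1 + s)) = c⁻¹ := by
      rw [show (1 - s) * (1 + s) = (c⁻¹) ^ 2 by field_simp; linarith,
        Real.sqrt_sq (by positivity)]
    rw [hsq]
    congr 2
    · field_simp
    · have hcC : (c : ℂ) ≠ 0 := by exact_mod_cast hc0.ne'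
      have hm : ((1 - s : ℝ) : ℂ) ≠ 0 := by exact_mod_cast (by linarith : (1 - s : ℝ) ≠ 0)
      have hpl : ((1 + s : ℝ) : ℂ) ≠ 0 := by exact_mod_cast (by linarith : (1 + s : ℝ) ≠ 0)
      have hs2' : (c : ℂ) ^ 2 * (((1 - s : ℝ) : ℂ) * ((1 + s : ℝ) : ℂ)) = 1 := by
        rw [← Complex.ofReal_mul, ← Complex.ofReal_pow, ← Complex.ofReal_mul,
          show (1 - s) * (1 + s) = 1 - s ^ 2 by ring, hs2, Complex.ofReal_one]
      have h1 : p ^ 2 / (4 * ((1 - s : ℝ) : ℂ)) =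
          (w * x + star w * y) ^ 2 * ((1 + s : ℝ) : ℂ) / 4 := by
        rw [hp]
        field_simp
        linear_combination (-(w * x + star w * y) ^ 2) * hs2'
      have h2 : q ^ 2 / (4 * ((1 + s : ℝ) : ℂ)) =
          -((w * x - star w * y) ^ 2 * ((1 - s : ℝ) : ℂ)) / 4 := by
        rw [hq, div_pow, mul_pow, Complex.I_sq]
        field_simp
        linear_combination ((w * x - star w * y) ^ 2) * hs2'
      rw [h1, h2, hd]
      push_cast
      linear_combination (x * y : ℂ) * hww

lemma continuous_squeezedAmp (ξ : ℂ) (k : ℕ) : Continuous fun α => squeezedAmp α ξ k := by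
  unfold squeezedAmp
  fun_prop

lemma measurable_inner_squeezedMode (ξ : ℂ) (φ : ModeSpace) :
    Measurable fun α => inner ℂ (squeezedMode ξ α) φ := by
  have h : ∀ α, inner ℂ (squeezedMode ξ α) φ = ∑' k, inner ℂ (squeezedAmp α ξ k) (φ k) := fun α =>
    ((lp.hasSum_inner (𝕜 := ℂ) (squeezedMode ξ α) φ).tsum_eq).symm
  simp only [h]
  exact Measurable.tsum fun k => ((continuous_squeezedAmp ξ k).inner continuous_const).measurable

/-- The measure `d²α / π` on the phase space of a mode. -/
def modeMeasure : Measure ℂ := ENNReal.ofReal Real.pi⁻¹ • volume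

lemma integral_modeMeasure {E : Type*} [NormedAddCommGroup E] [NormedSpace ℝ E] (f : ℂ → E) :
    ∫ α, f α ∂modeMeasure = Real.pi⁻¹ • ∫ α, f α := by
  rw [modeMeasure, integral_smul_measure, ENNReal.toReal_ofReal (by positivity)]

lemma resolvesIdentity_squeezedMode (ξ : ℂ) : ResolvesIdentity modeMeasure (squeezedMode ξ) := by
  refine .of_span_dense (measurable_inner_squeezedMode ξ) span_expVec_dense ?_
  rintro _ ⟨x, rfl⟩ _ ⟨y, rfl⟩
  obtain ⟨h1, h2⟩ := integral_squeezedGen ξ x y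
  have h3 : ∀ α, inner ℂ (expVec x) (squeezedMode ξ α) * inner ℂ (squeezedMode ξ α) (expVec y) =
      squeezedGen ξ α x * star (squeezedGen ξ α y) := fun α => by
    rw [← inner_conj_symm (squeezedMode ξ α), inner_expVec_squeezedMode, inner_expVec_squeezedMode]
    rfl
  simp only [h3]
  refine ⟨h1.smul_measure ENNReal.ofReal_ne_top, ?_⟩
  rw [integral_modeMeasure, h2, inner_expVec_expVec, Complex.real_smul, ← mul_assoc,
    ← Complex.ofReal_mul, inv_mul_cancel₀ Real.pi_ne_zero, Complex.ofReal_one, one_mul]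

lemma squeezedAmp_orthogonal (ξ : ℂ) (k l : ℕ) :
    Integrable (fun α => squeezedAmp α ξ k * star (squeezedAmp α ξ l)) modeMeasure ∧
      ∫ α, squeezedAmp α ξ k * star (squeezedAmp α ξ l) ∂modeMeasure = if k = l then 1 else 0 := by
  have hr := resolvesIdentity_squeezedMode ξ
  set φ : ℕ → ModeSpace := fun k => lp.single 2 k 1 with hφ
  have h1 : ∀ k α, inner ℂ (φ k) (squeezedMode ξ α) = squeezedAmp α ξ k := fun k α => by
    simp only [hφ]
    rw [lp.inner_single_left]
    simp [squeezedMode]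
  have h2 : ∀ k α, inner ℂ (squeezedMode ξ α) (φ k) = star (squeezedAmp α ξ k) := fun k α => by
    rw [← inner_conj_symm, h1]; rfl
  have h3 := hr.integrable_inner_mul_inner (φ k) (φ l)
  have h4 := hr.integral_inner_mul_inner (φ k) (φ l)
  simp only [h1, h2] at h3 h4
  refine ⟨h3, h4.trans ?_⟩
  simp only [hφ]
  rw [lp.inner_single_left, lp.single_apply]
  split_ifs with h
  · subst h; simp
  · simp [h]

/-! ### Multimode squeezed coherent states -/

/-- The measure `d^{2m}α / π^m` on the phase space of `m` modes. -/
def phaseMeasure (m : ℕ) : Measure (Fin m → ℂ) := ENNReal.ofReal (Real.pi ^ m)⁻¹ • volume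

instance (m : ℕ) : SigmaFinite (phaseMeasure m) := by
  unfold phaseMeasure
  exact inferInstanceAs
    (SigmaFinite (Real.toNNReal (Real.pi ^ m)⁻¹ • (volume : Measure (Fin m → ℂ))))

lemma integral_phaseMeasure_prod {m : ℕ} (f : Fin m → ℂ → ℂ) :
    ∫ α, ∏ i, f i (α i) ∂(phaseMeasure m) = ∏ i, ∫ z, f i z ∂modeMeasure := by
  rw [phaseMeasure, integral_smul_measure, ENNReal.toReal_ofReal (by positivity),
    integral_fintype_prod_volume_eq_prod]
  simp only [integral_modeMeasure, Complex.real_smul]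
  rw [Finset.prod_mul_distrib]
  simp

lemma integrable_phaseMeasure_prod {m : ℕ} {f : Fin m → ℂ → ℂ}
    (hf : ∀ i, Integrable (f i) modeMeasure) :
    Integrable (fun α => ∏ i, f i (α i)) (phaseMeasure m) := by
  have h : ∀ i, Integrable (f i) volume := fun i => by
    have hpi : ENNReal.ofReal Real.pi⁻¹ ≠ 0 := by
      simp [Real.pi_pos]
    exact (integrable_smul_measure hpi ENNReal.ofReal_ne_top).1 (hf i)
  exact (Integrable.fintype_prod h).smul_measure ENNReal.ofReal_ne_top

lemma inner_fockState_squeezedState {m : ℕ} (k : Fin m → ℕ) (α ξ : Fin m → ℂ) :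
    inner ℂ (fockState k) (squeezedState α ξ) = ∏ i, squeezedAmp (α i) (ξ i) (k i) :=
  inner_fockState k _

lemma span_fockState_dense (m : ℕ) :
    (Submodule.span ℂ (Set.range (fockState (m := m)))).topologicalClosure = ⊤ := by
  rw [Submodule.topologicalClosure_eq_top_iff, Submodule.eq_bot_iff]
  intro φ hφ
  ext k
  have := hφ _ (Submodule.subset_span ⟨k, rfl⟩)
  rwa [inner_fockState] at this

lemma measurable_inner_of_apply {X : Type*} [MeasurableSpace X] {m : ℕ} {v : X → FockSpace m}
    (hv : ∀ k, Measurable fun x => v x k) (φ : FockSpace m) :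
    Measurable fun x => inner ℂ (v x) φ := by
  have h : ∀ x, inner ℂ (v x) φ = ∑' k, inner ℂ (v x k) (φ k) := fun x =>
    ((lp.hasSum_inner (𝕜 := ℂ) (v x) φ).tsum_eq).symm
  simp only [h]
  exact Measurable.tsum fun k => (hv k).inner measurable_const

/-- Unbalanced heterodyne detection is a measurement. -/
theorem resolvesIdentity_squeezedState {m : ℕ} (ξ : Fin m → ℂ) :
    ResolvesIdentity (phaseMeasure m) fun α => squeezedState α ξ := by
  refine .of_span_dense (measurable_inner_of_apply fun k => ?_) (span_fockState_dense m) ?_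
  · change Measurable fun α : Fin m → ℂ => ∏ i, squeezedAmp (α i) (ξ i) (k i)
    exact Finset.measurable_fun_prod _ fun i _ =>
      (continuous_squeezedAmp (ξ i) (k i)).measurable.comp (measurable_pi_apply i)
  · rintro _ ⟨k, rfl⟩ _ ⟨l, rfl⟩
    have h : ∀ α, inner ℂ (fockState k) (squeezedState α ξ) *
        inner ℂ (squeezedState α ξ) (fockState l) =
        ∏ i, (squeezedAmp (α i) (ξ i) (k i) * star (squeezedAmp (α i) (ξ i) (l i))) := fun α => by
      rw [← inner_conj_symm (squeezedState α ξ), inner_fockState_squeezedState,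
        inner_fockState_squeezedState, map_prod, Finset.prod_mul_distrib]
      rfl
    simp only [h]
    refine ⟨integrable_phaseMeasure_prod fun i => (squeezedAmp_orthogonal (ξ i) (k i) (l i)).1, ?_⟩
    rw [integral_phaseMeasure_prod
      (fun i z => squeezedAmp z (ξ i) (k i) * star (squeezedAmp z (ξ i) (l i)))]
    simp only [(squeezedAmp_orthogonal _ _ _).2, inner_fockState, fockState_apply]
    rw [Finset.prod_ite_zero]
    simp [funext_iff]

lemma squeezedState_zero {m : ℕ} (α : Fin m → ℂ) : squeezedState α 0 = coherentState α := by
  ext k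
  change ∏ i, squeezedAmp (α i) 0 (k i) = ∏ i, coherentAmp (α i) (k i)
  simp only [squeezedAmp_zero]

/-- Balanced heterodyne detection is a measurement. -/
theorem resolvesIdentity_coherentState (m : ℕ) :
    ResolvesIdentity (phaseMeasure m) coherentState := by
  have h := resolvesIdentity_squeezedState (m := m) 0
  simpa only [squeezedState_zero] using h

lemma withDensity_weight_eq_outcome {m : ℕ} (v : (Fin m → ℂ) → FockSpace m)
    (ρ : FockSpace m →L[ℂ] FockSpace m) :
    (volume.withDensity fun α => ENNReal.ofReal ((inner ℂ (v α) (ρ (v α))).re / Real.pi ^ m)) =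
      outcome (phaseMeasure m) v ρ := by
  rw [outcome, phaseMeasure, withDensity_smul_measure,
    ← withDensity_smul' _ _ ENNReal.ofReal_ne_top]
  congr 1
  ext α
  rw [Pi.smul_apply, smul_eq_mul, ← ENNReal.ofReal_mul (by positivity), weight, div_eq_inv_mul]

lemma unbalancedHeterodyne_eq_outcome {m : ℕ} (ξ : Fin m → ℂ)
    (ρ : FockSpace m →L[ℂ] FockSpace m) :
    unbalancedHeterodyne ξ ρ = outcome (phaseMeasure m) (fun α => squeezedState α ξ) ρ :=
  withDensity_weight_eq_outcome _ _

lemma heterodyne_eq_outcome {m : ℕ} (ρ : FockSpace m →L[ℂ] FockSpace m) :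
    heterodyne ρ = outcome (phaseMeasure m) coherentState ρ :=
  withDensity_weight_eq_outcome _ _

/-- A state of high fidelity passes all measurements: `TV ≤ √(1 - F^M) < d`. -/
theorem samplesClose_of_weight {m : ℕ} {M : ℕ} {ρ : FockSpace m →L[ℂ] FockSpace m}
    {ψ : FockSpace m} (hρ : IsDensity ρ) (hψ : ‖ψ‖ = 1) {d : ℝ}
    (hd : Real.sqrt (1 - weight ρ ψ ^ M) < d) : SamplesClose M ρ (pureState ψ) d := by
  have hP := resolvesIdentity_fockState m
  have : IsProbabilityMeasure (photonCounting ρ) := hP.isProbabilityMeasure_outcome hρ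
  have : IsProbabilityMeasure (photonCounting (pureState ψ)) :=
    hP.isProbabilityMeasure_outcome (isDensity_pureState hψ)
  have h1 := (hP.tvDist_iid_outcome_le hρ hψ M).trans_lt hd
  refine ⟨fun ξ => ?_, h1, ?_⟩
  · rw [unbalancedHeterodyne_eq_outcome, unbalancedHeterodyne_eq_outcome]
    exact ((resolvesIdentity_squeezedState ξ).tvDist_iid_outcome_le hρ hψ M).trans_lt hd
  · exact (tvDist_iid_map_le (measurable_of_countable _) M).trans_lt h1

/-! ### Passive linear transformations -/

section passive

variable {m : ℕ} {U : Matrix (Fin m) (Fin m) ℂ}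

/-- The rotated Fock state `Û |l⟩`. -/
def rotatedFock (U : Matrix (Fin m) (Fin m) ℂ) (l : Fin m → ℕ) : FockSpace m :=
  toFockSpace (passiveLinear U (Finsupp.single l 1))

/-- The linear functional `c ↦ ⟨γ|c⟩` on finite superpositions of Fock states. -/
def coherentFunctional (γ : Fin m → ℂ) : FiniteFock m →ₗ[ℂ] ℂ :=
  (innerSL ℂ (coherentState γ)).toLinearMap ∘ₗ Finsupp.linearCombination ℂ fockState

lemma coherentFunctional_apply (γ : Fin m → ℂ) (c : FiniteFock m) :
    coherentFunctional γ c = inner ℂ (coherentState γ) (toFockSpace c) := rfl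

lemma coherentFunctional_single (γ : Fin m → ℂ) (k : Fin m → ℕ) :
    coherentFunctional γ (Finsupp.single k 1) = star (∏ i, coherentAmp (γ i) (k i)) := by
  simp only [coherentFunctional, LinearMap.comp_apply, Finsupp.linearCombination_single, one_smul]
  change inner ℂ (coherentState γ) (fockState k) = _
  rw [← inner_conj_symm, inner_fockState]
  rfl

lemma sqrt_mul_coherentAmp_succ (z : ℂ) (k : ℕ) :
    ((Real.sqrt (k + 1) : ℝ) : ℂ) * coherentAmp z (k + 1) = z * coherentAmp z k := by
  have h1 : (0 : ℝ) < k + 1 := by positivity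
  have h2 : ((Real.sqrt (k + 1) : ℝ) : ℂ) ≠ 0 := by exact_mod_cast (Real.sqrt_pos.2 h1).ne'
  rw [coherentAmp, coherentAmp, Nat.factorial_succ, Nat.cast_mul, Nat.cast_succ,
    Real.sqrt_mul h1.le, Complex.ofReal_mul, pow_succ]
  field_simp
  ring

/-- Coherent states are eigenvectors of the annihilation operators. -/
lemma coherentFunctional_creation (γ : Fin m → ℂ) (i : Fin m) (c : FiniteFock m) :
    coherentFunctional γ (creation i c) = star (γ i) * coherentFunctional γ c := by
  have h : coherentFunctional γ ∘ₗ creation i = star (γ i) • coherentFunctional γ := by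
    refine Finsupp.lhom_ext' fun k => LinearMap.ext_ring ?_
    have hc : creation i (Finsupp.single k (1 : ℂ)) =
        ((Real.sqrt (k i + 1) : ℝ) : ℂ) • Finsupp.single (k + Pi.single i 1) (1 : ℂ) := by
      simp [creation]
    simp only [LinearMap.comp_apply, Finsupp.lsingle_apply, LinearMap.smul_apply, hc, map_smul,
      coherentFunctional_single, smul_eq_mul]
    have hs : ∀ r : ℝ, ((r : ℝ) : ℂ) = star (r : ℂ) := fun r => (Complex.conj_ofReal r).symm
    rw [hs, ← star_mul', ← star_mul']
    congr 1
    rw [← Finset.mul_prod_erase _ _ (Finset.mem_univ i),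
      ← Finset.mul_prod_erase _ (fun j => coherentAmp (γ j) (k j)) (Finset.mem_univ i),
      ← mul_assoc, ← mul_assoc, Pi.add_apply, Pi.single_eq_same, sqrt_mul_coherentAmp_succ]
    congr 1
    refine Finset.prod_congr rfl fun j hj => ?_
    rw [Pi.add_apply, Pi.single_eq_of_ne (Finset.ne_of_mem_erase hj), add_zero]
  exact LinearMap.congr_fun h c

lemma coherentFunctional_rotatedCreation (γ : Fin m → ℂ) (j : Fin m) (c : FiniteFock m) :
    coherentFunctional γ (rotatedCreation U j c) =
      star ((Uᴴ *ᵥ γ) j) * coherentFunctional γ c := by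
  simp only [rotatedCreation, LinearMap.sum_apply, LinearMap.smul_apply, map_sum, map_smul,
    coherentFunctional_creation, smul_eq_mul, Matrix.mulVec, dotProduct,
    Matrix.conjTranspose_apply, star_sum, star_mul', star_star, Finset.sum_mul, mul_assoc]

lemma norm_sq_sum_conjTranspose_mulVec (hU : U ∈ Matrix.unitaryGroup (Fin m) ℂ) (γ : Fin m → ℂ) :
    ∑ i, ‖(Uᴴ *ᵥ γ) i‖ ^ 2 = ∑ i, ‖γ i‖ ^ 2 := by
  have h0 : ∀ w : Fin m → ℂ, star w ⬝ᵥ w = ((∑ i, ‖w i‖ ^ 2 : ℝ) : ℂ) := fun w => by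
    simp only [dotProduct, Pi.star_apply, Complex.ofReal_sum]
    refine Finset.sum_congr rfl fun i _ => ?_
    rw [Complex.star_def, mul_comm, Complex.mul_conj, Complex.normSq_eq_norm_sq]
  have h1 : star (Uᴴ *ᵥ γ) ⬝ᵥ (Uᴴ *ᵥ γ) = star γ ⬝ᵥ γ := by
    rw [Matrix.star_mulVec, Matrix.conjTranspose_conjTranspose, Matrix.dotProduct_mulVec,
      Matrix.vecMul_vecMul, ← Matrix.star_eq_conjTranspose, Matrix.mem_unitaryGroup_iff.1 hU,
      Matrix.vecMul_one]
  rw [h0, h0] at h1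
  exact Complex.ofReal_injective h1

/-- `Û` maps coherent states to coherent states: `⟨γ|Û|l⟩ = ⟨U†γ|l⟩`. -/
theorem inner_rotatedFock_coherentState (hU : U ∈ Matrix.unitaryGroup (Fin m) ℂ)
    (l : Fin m → ℕ) (γ : Fin m → ℂ) :
    inner ℂ (rotatedFock U l) (coherentState γ) = coherentState (Uᴴ *ᵥ γ) l := by
  rw [← inner_conj_symm, rotatedFock, ← coherentFunctional_apply]
  set β := Uᴴ *ᵥ γ with hβ
  have hpow : ∀ (j : Fin m) (r : ℕ) (c : FiniteFock m),
      coherentFunctional γ ((rotatedCreation U j ^ r) c) =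
        star (β j) ^ r * coherentFunctional γ c := by
    intro j r
    induction r with
    | zero => simp
    | succ r ih =>
      intro c
      rw [pow_succ, Module.End.mul_apply, ih, coherentFunctional_rotatedCreation, pow_succ,
        mul_assoc]
  have hprod : ∀ (L : List (Fin m)) (c : FiniteFock m),
      coherentFunctional γ ((L.map fun j => rotatedCreation U j ^ l j).prod c) =
        (L.map fun j => star (β j) ^ l j).prod * coherentFunctional γ c := by
    intro L
    induction L with
    | nil => simp
    | cons j L ih =>
      intro c
      rw [List.map_cons, List.prod_cons, Module.End.mul_apply, hpow, ih, List.map_cons,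
        List.prod_cons, mul_assoc]
  have hvac : coherentFunctional γ (Finsupp.single 0 1) =
      ∏ j, Complex.exp (-(‖β j‖ ^ 2 / 2 : ℝ)) := by
    rw [coherentFunctional_single, ← Complex.exp_sum, Finset.sum_neg_distrib]
    have h := norm_sq_sum_conjTranspose_mulVec hU γ
    rw [← hβ] at h
    have h2 : ∑ j, ((‖β j‖ ^ 2 / 2 : ℝ) : ℂ) = ∑ j, ((‖γ j‖ ^ 2 / 2 : ℝ) : ℂ) := by
      rw [← Complex.ofReal_sum, ← Complex.ofReal_sum, ← Finset.sum_div, ← Finset.sum_div, h]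
    rw [h2, ← Finset.sum_neg_distrib, Complex.exp_sum, Complex.star_def, map_prod]
    refine Finset.prod_congr rfl fun j _ => ?_
    rw [coherentAmp, ← Complex.ofReal_neg, ← Complex.ofReal_exp, Pi.zero_apply, pow_zero, mul_one,
      Nat.factorial_zero, Nat.cast_one, Real.sqrt_one, Complex.ofReal_one, div_one,
      Complex.conj_ofReal]
  have hl : passiveLinear U (Finsupp.single l 1) =
      (((Real.sqrt (∏ j : Fin m, ((l j).factorial : ℝ)))⁻¹ : ℝ) : ℂ) •
        (List.ofFn fun j : Fin m => rotatedCreation U j ^ l j).prod (Finsupp.single 0 1) := by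
    simp [passiveLinear]
  rw [hl, map_smul, List.ofFn_eq_map, hprod, ← List.ofFn_eq_map, List.prod_ofFn, hvac,
    smul_eq_mul, map_mul, Complex.conj_ofReal, map_mul, map_prod, map_prod]
  change _ = ∏ j, coherentAmp (β j) (l j)
  have hsq : Real.sqrt (∏ j : Fin m, ((l j).factorial : ℝ)) =
      ∏ j, Real.sqrt ((l j).factorial : ℝ) :=
    Real.sqrt_prod _ fun j _ => by positivity
  rw [hsq, Complex.ofReal_inv, Complex.ofReal_prod, ← Finset.prod_inv_distrib,
    ← Finset.prod_mul_distrib, ← Finset.prod_mul_distrib]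
  refine Finset.prod_congr rfl fun j _ => ?_
  rw [coherentAmp, ← Complex.ofReal_neg, ← Complex.ofReal_exp, Complex.conj_ofReal]
  simp only [map_pow, Complex.star_def, Complex.conj_conj]
  rw [div_eq_inv_mul]
  ring

lemma measurePreserving_conjTranspose_mulVec (hU : U ∈ Matrix.unitaryGroup (Fin m) ℂ) :
    MeasurePreserving (fun γ => Uᴴ *ᵥ γ) (phaseMeasure m) (phaseMeasure m) := by
  have hdet : Algebra.norm ℝ (LinearMap.det (Matrix.toLin' Uᴴ)) = 1 := by
    rw [LinearMap.det_toLin', Matrix.det_conjTranspose, Algebra.norm_complex_eq]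
    have h := congrArg Matrix.det (Matrix.mem_unitaryGroup_iff.1 hU)
    rw [Matrix.det_mul, Matrix.star_eq_conjTranspose, Matrix.det_conjTranspose, Matrix.det_one,
      Complex.star_def, Complex.mul_conj] at h
    have h2 : Complex.normSq U.det = 1 := by exact_mod_cast h
    simpa using h2
  set L : (Fin m → ℂ) →ₗ[ℝ] (Fin m → ℂ) := (Matrix.toLin' Uᴴ).restrictScalars ℝ with hL
  have hLdet : LinearMap.det L = 1 := by rw [hL, LinearMap.det_restrictScalars, hdet]
  have hmap : (volume : Measure (Fin m → ℂ)).map L = volume := by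
    rw [Measure.map_linearMap_addHaar_eq_smul_addHaar _ (by rw [hLdet]; exact one_ne_zero), hLdet]
    simp
  have hfun : (fun γ => Uᴴ *ᵥ γ) = L := by
    ext γ i; simp [hL]
  refine ⟨?_, ?_⟩
  · rw [hfun]; exact (LinearMap.continuous_of_finiteDimensional L).measurable
  · rw [hfun, phaseMeasure, Measure.map_smul, hmap]

lemma continuous_coherentAmp (k : ℕ) : Continuous fun z => coherentAmp z k := by
  simpa only [squeezedAmp_zero] using continuous_squeezedAmp 0 k

lemma measurable_coherentState_apply (k : Fin m → ℕ) :
    Measurable fun α : Fin m → ℂ => coherentState α k := by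
  change Measurable fun α : Fin m → ℂ => ∏ i, coherentAmp (α i) (k i)
  exact Finset.measurable_fun_prod _ fun i _ =>
    (continuous_coherentAmp (k i)).measurable.comp (measurable_pi_apply i)

/-- The overlap `⟨Û k|Û l⟩` is computed with coherent states, on which `Û` acts as a change of
variables in phase space. -/
lemma orthonormal_rotatedFock (hU : U ∈ Matrix.unitaryGroup (Fin m) ℂ) :
    Orthonormal ℂ (rotatedFock U) := by
  classical
  have hr := resolvesIdentity_coherentState m
  rw [orthonormal_iff_ite]
  intro k l
  rw [← hr.integral_inner_mul_inner]
  have h1 : ∀ γ, inner ℂ (rotatedFock U k) (coherentState γ) *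
      inner ℂ (coherentState γ) (rotatedFock U l) =
      (fun α : Fin m → ℂ => coherentState α k * star (coherentState α l)) (Uᴴ *ᵥ γ) := fun γ => by
    rw [← inner_conj_symm (coherentState γ), inner_rotatedFock_coherentState hU,
      inner_rotatedFock_coherentState hU]
    rfl
  have hmp := measurePreserving_conjTranspose_mulVec hU
  have hmeas : Measurable fun α : Fin m → ℂ => coherentState α k * star (coherentState α l) :=
    (measurable_coherentState_apply k).mul
      (continuous_star.measurable.comp (measurable_coherentState_apply l))
  simp only [h1]
  rw [← integral_map (φ := fun γ => Uᴴ *ᵥ γ) hmp.measurable.aemeasurable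
    hmeas.aestronglyMeasurable, hmp.map_eq]
  have h2 := hr.integral_inner_mul_inner (fockState k) (fockState l)
  have h3 : ∀ α : Fin m → ℂ, inner ℂ (fockState k) (coherentState α) *
      inner ℂ (coherentState α) (fockState l) = coherentState α k * star (coherentState α l) :=
    fun α => by
      rw [← inner_conj_symm (coherentState α), inner_fockState, inner_fockState]; rfl
  simp only [h3] at h2
  rw [h2, inner_fockState, fockState_apply]

/-- The isometry `Û`, on the whole Hilbert space. -/
def passiveIsometry (hU : U ∈ Matrix.unitaryGroup (Fin m) ℂ) : FockSpace m →ₗᵢ[ℂ] FockSpace m :=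
  (orthonormal_rotatedFock hU).orthogonalFamily.linearIsometry

lemma hasSum_passiveIsometry (hU : U ∈ Matrix.unitaryGroup (Fin m) ℂ) (φ : FockSpace m) :
    HasSum (fun l => φ l • rotatedFock U l) (passiveIsometry hU φ) := by
  have h := (orthonormal_rotatedFock hU).orthogonalFamily.hasSum_linearIsometry φ
  simp only [LinearIsometry.toSpanSingleton_apply] at h
  exact h

lemma inner_passiveIsometry_coherentState (hU : U ∈ Matrix.unitaryGroup (Fin m) ℂ)
    (γ : Fin m → ℂ) :
    inner ℂ (coherentState γ) (passiveIsometry hU (coherentState (Uᴴ *ᵥ γ))) =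
      ((‖coherentState (Uᴴ *ᵥ γ)‖ ^ 2 : ℝ) : ℂ) := by
  have h := (hasSum_passiveIsometry hU (coherentState (Uᴴ *ᵥ γ))).mapL
    (innerSL ℂ (coherentState γ))
  have h2 := lp.hasSum_inner (𝕜 := ℂ) (coherentState (Uᴴ *ᵥ γ)) (coherentState (Uᴴ *ᵥ γ))
  rw [inner_self_eq_norm_sq_to_K] at h2
  refine (h.unique ?_).trans (Complex.ofReal_pow _ _).symm
  refine (congrArg (fun F => HasSum F _) (funext fun l => ?_)).mpr h2
  rw [map_smul, innerSL_apply_apply, ← inner_conj_symm (coherentState γ),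
    inner_rotatedFock_coherentState hU, smul_eq_mul, RCLike.inner_apply]

lemma norm_coherentState_conjTranspose_le (hU : U ∈ Matrix.unitaryGroup (Fin m) ℂ)
    (γ : Fin m → ℂ) : ‖coherentState (Uᴴ *ᵥ γ)‖ ≤ ‖coherentState γ‖ := by
  have h := norm_inner_le_norm (𝕜 := ℂ) (coherentState γ)
    (passiveIsometry hU (coherentState (Uᴴ *ᵥ γ)))
  rw [inner_passiveIsometry_coherentState, LinearIsometry.norm_map, Complex.norm_real,
    Real.norm_of_nonneg (by positivity), sq] at h
  rcases (norm_nonneg (coherentState (Uᴴ *ᵥ γ))).eq_or_lt with h0 | h0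
  · rw [← h0]; exact norm_nonneg _
  · exact le_of_mul_le_mul_right h h0

/-- `Û |U†γ⟩ = |γ⟩`: both sides have the same norm, and their overlap attains the Cauchy-Schwarz
bound. -/
lemma passiveIsometry_coherentState (hU : U ∈ Matrix.unitaryGroup (Fin m) ℂ) (γ : Fin m → ℂ) :
    passiveIsometry hU (coherentState (Uᴴ *ᵥ γ)) = coherentState γ := by
  have hU' : Uᴴ ∈ Matrix.unitaryGroup (Fin m) ℂ := Unitary.star_mem hU
  have hn : ‖coherentState (Uᴴ *ᵥ γ)‖ = ‖coherentState γ‖ := by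
    refine le_antisymm (norm_coherentState_conjTranspose_le hU γ) ?_
    have h := norm_coherentState_conjTranspose_le hU' (Uᴴ *ᵥ γ)
    rwa [Matrix.mulVec_mulVec, Matrix.conjTranspose_conjTranspose, ← Matrix.star_eq_conjTranspose,
      Matrix.mem_unitaryGroup_iff.1 hU, Matrix.one_mulVec] at h
  rw [← sub_eq_zero, ← norm_eq_zero, ← sq_eq_zero_iff, @norm_sub_sq ℂ, LinearIsometry.norm_map,
    ← inner_conj_symm, inner_passiveIsometry_coherentState]
  simp only [Complex.conj_ofReal, RCLike.re_to_complex, Complex.ofReal_re]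
  rw [hn]; ring

/-- Photon counting after undoing `Û`: the rotated Fock states form an orthonormal basis. -/
theorem resolvesIdentity_rotatedFock (hU : U ∈ Matrix.unitaryGroup (Fin m) ℂ) :
    ResolvesIdentity (Measure.count : Measure (Fin m → ℕ)) (rotatedFock U) := by
  have hbot : (Submodule.span ℂ (Set.range (rotatedFock U)))ᗮ = ⊥ := by
    rw [Submodule.eq_bot_iff]
    intro φ hφ
    refine (resolvesIdentity_coherentState m).eq_zero fun γ => ?_
    rw [← passiveIsometry_coherentState hU γ, ← inner_conj_symm]
    have h := (hasSum_passiveIsometry hU (coherentState (Uᴴ *ᵥ γ))).mapL (innerSL ℂ φ)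
    have h0 : ∀ l, inner ℂ φ (rotatedFock U l) = 0 := fun l => by
      rw [← inner_conj_symm, hφ _ (Submodule.subset_span ⟨l, rfl⟩), map_zero]
    simp only [map_smul, innerSL_apply_apply, h0, smul_zero] at h
    rw [h.unique hasSum_zero, map_zero]
  set b := HilbertBasis.mkOfOrthogonalEqBot (orthonormal_rotatedFock hU) hbot with hb
  refine resolvesIdentity_of_lintegral (fun φ => measurable_of_countable _) fun φ => ?_
  rw [lintegral_count]
  have h := tsum_enorm_apply_sq (b.repr φ)
  have hbr : ∀ l, b.repr φ l = inner ℂ (rotatedFock U l) φ := fun l => by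
    rw [b.repr_apply_apply, hb, HilbertBasis.coe_mkOfOrthogonalEqBot]
  simp only [hbr] at h
  rw [h, enorm_eq_nnnorm, b.repr.nnnorm_map, enorm_eq_nnnorm]

end passive

/-! ### The fidelity witness -/

/-- Union bound for `M` independent samples: all samples hit the intersection of the events `A i`
unless, for some `i`, one of them misses `A i`. -/
lemma one_sub_pow_measureReal_iInter_le {Ω : Type*} [MeasurableSpace Ω] (P : Measure Ω)
    [IsProbabilityMeasure P] {ι : Type*} [Fintype ι] {A : ι → Set Ω}
    (hA : ∀ i, MeasurableSet (A i)) (M : ℕ) :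
    1 - P.real (⋂ i, A i) ^ M ≤ ∑ i, (1 - P.real (A i) ^ M) := by
  set Q := Measure.pi fun _ : Fin M => P with hQ
  have hpi : ∀ B : Set Ω, Q.real (Set.univ.pi fun _ : Fin M => B) = P.real B ^ M := fun B => by
    rw [measureReal_def, hQ, Measure.pi_pi, Finset.prod_const, Finset.card_univ, Fintype.card_fin,
      ENNReal.toReal_pow]; rfl
  have hcompl : ∀ {B : Set Ω}, MeasurableSet B →
      Q.real (Set.univ.pi fun _ : Fin M => B)ᶜ = 1 - P.real B ^ M := fun {B} hB => by
    rw [measureReal_compl (MeasurableSet.univ_pi fun _ => hB), hpi, probReal_univ]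
  rw [← hcompl (MeasurableSet.iInter hA)]
  have hsub : (Set.univ.pi fun _ : Fin M => ⋂ i, A i)ᶜ ⊆
      ⋃ i, (Set.univ.pi fun _ : Fin M => A i)ᶜ := by
    intro x hx
    simp only [Set.mem_compl_iff, Set.mem_univ_pi, Set.mem_iInter, not_forall,
      Set.mem_iUnion] at hx ⊢
    obtain ⟨j, i, h⟩ := hx
    exact ⟨i, j, h⟩
  refine (measureReal_mono hsub).trans ((measureReal_iUnion_fintype_le _).trans (le_of_eq ?_))
  exact Finset.sum_congr rfl fun i _ => hcompl (hA i)

section witness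

variable {m : ℕ} {U : Matrix (Fin m) (Fin m) ℂ} {ρ : FockSpace m →L[ℂ] FockSpace m}

/-- The single-mode fidelity: the probability of finding the photon number `k` in mode `i` of
`Û† ρ Û`. -/
def modeFidelity (U : Matrix (Fin m) (Fin m) ℂ) (ρ : FockSpace m →L[ℂ] FockSpace m) (i : Fin m)
    (k : ℕ) : ℝ :=
  (outcome Measure.count (rotatedFock U) ρ).real {l | l i = k}

/-- The fidelity with `Û |k⟩` of `M` copies is bounded from the single-mode fidelities. -/
theorem one_sub_weight_pow_le (hU : U ∈ Matrix.unitaryGroup (Fin m) ℂ) (hρ : IsDensity ρ)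
    (k : Fin m → ℕ) (M : ℕ) :
    1 - weight ρ (rotatedFock U k) ^ M ≤ ∑ i, (1 - modeFidelity U ρ i (k i) ^ M) := by
  have := (resolvesIdentity_rotatedFock hU).isProbabilityMeasure_outcome hρ
  have h := one_sub_pow_measureReal_iInter_le (outcome Measure.count (rotatedFock U) ρ)
    (A := fun i => {l : Fin m → ℕ | l i = k i}) (fun i => (Set.to_countable _).measurableSet) M
  have hI : ⋂ i, {l : Fin m → ℕ | l i = k i} = {k} := by
    ext l; simp [funext_iff]
  have hw : (outcome Measure.count (rotatedFock U) ρ).real {k} = weight ρ (rotatedFock U k) := by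
    rw [measureReal_def, outcome, withDensity_apply _ (measurableSet_singleton k),
      Measure.restrict_singleton, lintegral_smul_measure, lintegral_dirac, Measure.count_singleton,
      one_smul, ENNReal.toReal_ofReal (hρ.weight_nonneg _)]
  rw [hI, hw] at h
  exact h

end witness

/-! ### The estimator functions on single-mode Fock states -/

section combinatorics

/-- The `l`-th finite difference of `x ↦ binom(x, n)` at `x = n`. -/
lemma sum_neg_one_pow_choose_mul_choose (n l : ℕ) :
    ∑ q ∈ Finset.range (l + 1), (-1 : ℤ) ^ q * (l.choose q) * ((n + l - q).choose n) =
      n.choose l := by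
  have h := fwdDiff_iter_eq_sum_shift 1 (fun x : ℕ => (x.choose n : ℤ)) l n
  rw [← Finset.sum_range_reflect] at h
  have h1 : ∑ q ∈ Finset.range (l + 1), (-1 : ℤ) ^ q * (l.choose q) * ((n + l - q).choose n) =
      (fwdDiff 1)^[l] (fun x : ℕ => (x.choose n : ℤ)) n := by
    rw [h]
    refine Finset.sum_congr rfl fun q hq => ?_
    have hq' : q ≤ l := by have := Finset.mem_range.1 hq; omega
    rw [show l + 1 - 1 - q = l - q by omega, Nat.sub_sub_self hq', Nat.choose_symm hq',
      smul_eq_mul, smul_eq_mul, mul_one, Nat.add_sub_assoc hq']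
  rw [h1]
  rcases le_or_gt l n with hln | hln
  · obtain ⟨j, rfl⟩ := Nat.exists_eq_add_of_le hln
    rw [fwdDiff_iter_choose, Nat.choose_symm_add]
  · obtain ⟨r, rfl⟩ := Nat.exists_eq_add_of_lt hln
    have h0 := fwdDiff_iter_choose 0 n
    rw [add_zero] at h0
    rw [show n + r + 1 = r + 1 + n by ring, Function.iterate_add_apply, h0]
    simp only [Nat.choose_zero_right, Nat.cast_one, Function.iterate_succ_apply, fwdDiff_const]
    rw [Nat.choose_eq_zero_of_lt (by omega), fwdDiff_iter_eq_sum_shift]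
    simp

end combinatorics

section estimator

variable {η : ℝ}

/-- The functions `f_l` of the protocol, as functions of `x = |z|²`. -/
def fRadial (η : ℝ) (l : ℕ) (x : ℝ) : ℝ :=
  ∑ q ∈ Finset.range (l + 1), (l.factorial : ℝ) * (-1) ^ q /
    (q.factorial * ((l - q).factorial : ℝ) ^ 2) / (η ^ (l + 1) * η ^ (l - q)) *
      (x ^ (l - q) * Real.exp ((1 - 1 / η) * x))

lemma fEst_self (hη : 0 < η) (l : ℕ) (z : ℂ) :
    fEst l l z η = (fRadial η l (‖z‖ ^ 2) : ℝ) := by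
  have hexp : (1 + ((l : ℝ) + l) / 2) = ((l + 1 : ℕ) : ℝ) := by push_cast; ring
  have hz : ∀ r : ℕ, (z / (Real.sqrt η : ℝ)) ^ r * star (z / (Real.sqrt η : ℝ)) ^ r =
      ((‖z‖ ^ 2 / η : ℝ) : ℂ) ^ r := by
    intro r
    rw [← mul_pow, Complex.star_def, Complex.mul_conj, Complex.normSq_eq_norm_sq, norm_div,
      Complex.norm_real, Real.norm_of_nonneg (Real.sqrt_nonneg _), div_pow, Real.sq_sqrt hη.le]
  have hl : ((Real.sqrt l.factorial : ℝ) : ℂ) * (Real.sqrt l.factorial : ℝ) =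
      (l.factorial : ℂ) := by
    rw [← Complex.ofReal_mul, Real.mul_self_sqrt (by positivity)]; simp
  rw [fEst, hexp, Real.rpow_natCast, laguerre2D, min_self, fRadial, Complex.ofReal_sum,
    Finset.mul_sum]
  refine Finset.sum_congr rfl fun q _ => ?_
  rw [mul_assoc (_ / _) (_ ^ _) (_ ^ _), hz, hl]
  push_cast
  rw [div_pow]
  have hη' : (η : ℂ) ≠ 0 := by exact_mod_cast hη.ne'
  field_simp

lemma gEst_self_re (hη : 0 < η) (p k : ℕ) (z : ℂ) :
    (gEst p k k z η).re =
      ∑ j ∈ Finset.range p, (-1) ^ j * η ^ j * ((k + j).choose k : ℝ) *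
        fRadial η (k + j) (‖z‖ ^ 2) := by
  rw [← Complex.ofReal_re (∑ j ∈ Finset.range p, _), gEst]
  congr 1
  push_cast
  refine Finset.sum_congr rfl fun j _ => ?_
  rw [fEst_self hη, Real.sqrt_mul_self (by positivity)]
  push_cast
  ring

lemma continuous_gEst_re (hη : 0 < η) (p k : ℕ) : Continuous fun z => (gEst p k k z η).re := by
  simp only [gEst_self_re hη, fRadial]
  fun_prop

lemma exists_bound_fRadial (hη : 0 < η) (hη1 : η < 1) (l : ℕ) :
    ∃ B, ∀ x, 0 ≤ x → |fRadial η l x| ≤ B := by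
  have hc : 0 < 1 / η - 1 := by
    rw [sub_pos, lt_div_iff₀ hη]; linarith
  have hmono : ∀ (r : ℕ) (x : ℝ), 0 ≤ x →
      |x ^ r * Real.exp ((1 - 1 / η) * x)| ≤ r.factorial / (1 / η - 1) ^ r := by
    intro r x hx
    have h := Real.pow_div_factorial_le_exp ((1 / η - 1) * x) (by positivity) r
    rw [abs_of_nonneg (by positivity), show (1 - 1 / η) * x = -((1 / η - 1) * x) by ring,
      Real.exp_neg, ← div_eq_mul_inv, div_le_div_iff₀ (Real.exp_pos _) (by positivity)]
    rw [div_le_iff₀ (by positivity), mul_pow] at h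
    linarith
  refine ⟨∑ q ∈ Finset.range (l + 1), |(l.factorial : ℝ) * (-1) ^ q /
    (q.factorial * ((l - q).factorial : ℝ) ^ 2) / (η ^ (l + 1) * η ^ (l - q))| *
      ((l - q).factorial / (1 / η - 1) ^ (l - q)), fun x hx => ?_⟩
  refine (Finset.abs_sum_le_sum_abs _ _).trans (Finset.sum_le_sum fun q _ => ?_)
  rw [abs_mul]
  gcongr
  exact hmono _ _ hx

lemma exists_bound_gEst (hη : 0 < η) (hη1 : η < 1) (p k : ℕ) :
    ∃ B, ∀ z, |(gEst p k k z η).re| ≤ B := by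
  choose B hB using exists_bound_fRadial hη hη1
  refine ⟨∑ j ∈ Finset.range p, |(-1) ^ j * η ^ j * ((k + j).choose k : ℝ)| * B (k + j),
    fun z => ?_⟩
  rw [gEst_self_re hη]
  refine (Finset.abs_sum_le_sum_abs _ _).trans (Finset.sum_le_sum fun j _ => ?_)
  rw [abs_mul]
  gcongr
  exact hB _ _ (by positivity)

lemma norm_coherentAmp_sq (z : ℂ) (n : ℕ) :
    ‖coherentAmp z n‖ ^ 2 = Real.exp (-‖z‖ ^ 2) * (‖z‖ ^ 2) ^ n / n.factorial := by
  rw [coherentAmp, norm_div, norm_mul, norm_pow, ← Complex.ofReal_neg, ← Complex.ofReal_exp,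
    Complex.norm_real, Complex.norm_real, Real.norm_of_nonneg (Real.exp_pos _).le,
    Real.norm_of_nonneg (Real.sqrt_nonneg _), div_pow, Real.sq_sqrt (by positivity), mul_pow,
    ← Real.exp_nat_mul, ← pow_mul, ← pow_mul, mul_comm n 2]
  congr 3
  push_cast; ring

lemma integral_pow_mul_exp_modeMeasure {b : ℝ} (hb : 0 < b) (a : ℕ) :
    Integrable (fun z : ℂ => (‖z‖ ^ 2) ^ a * Real.exp (-b * ‖z‖ ^ 2)) modeMeasure ∧
      ∫ z : ℂ, (‖z‖ ^ 2) ^ a * Real.exp (-b * ‖z‖ ^ 2) ∂modeMeasure =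
        a.factorial / b ^ (a + 1) := by
  have h := Complex.integral_rpow_mul_exp_neg_mul_rpow (p := 2) (q := 2 * a) (b := b)
    one_le_two (by have : (0 : ℝ) ≤ a := by positivity
                   linarith) hb
  have h1 : ∀ z : ℂ, ‖z‖ ^ (2 * a : ℝ) * Real.exp (-b * ‖z‖ ^ (2 : ℝ)) =
      (‖z‖ ^ 2) ^ a * Real.exp (-b * ‖z‖ ^ 2) := fun z => by
    rw [Real.rpow_mul (norm_nonneg _), Real.rpow_natCast, Real.rpow_two]
  have h2 : ((2 * a : ℝ) + 2) / 2 = ((a + 1 : ℕ) : ℝ) := by push_cast; ring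
  simp only [h1] at h
  have hv : ∫ z : ℂ, (‖z‖ ^ 2) ^ a * Real.exp (-b * ‖z‖ ^ 2) =
      Real.pi * (a.factorial / b ^ (a + 1)) := by
    rw [h, neg_div, h2, Real.rpow_neg hb.le, Real.rpow_natCast, Nat.cast_succ,
      Real.Gamma_nat_eq_factorial]
    field_simp
  have hi : Integrable (fun z : ℂ => (‖z‖ ^ 2) ^ a * Real.exp (-b * ‖z‖ ^ 2)) volume := by
    refine Integrable.of_integral_ne_zero ?_
    rw [hv]
    have := Real.pi_pos
    positivity
  refine ⟨hi.smul_measure ENNReal.ofReal_ne_top, ?_⟩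
  rw [integral_modeMeasure, hv, smul_eq_mul, ← mul_assoc, inv_mul_cancel₀ Real.pi_ne_zero, one_mul]

/-- The expected value of `f` over the Husimi function of the Fock state `|n⟩`. -/
def modeMean (f : ℂ → ℝ) (n : ℕ) : ℝ := ∫ z, f z * ‖coherentAmp z n‖ ^ 2 ∂modeMeasure

lemma fRadial_mean (hη : 0 < η) (l n : ℕ) :
    Integrable (fun z : ℂ => fRadial η l (‖z‖ ^ 2) * ‖coherentAmp z n‖ ^ 2) modeMeasure ∧
      modeMean (fun z => fRadial η l (‖z‖ ^ 2)) n = η ^ n / η ^ l * n.choose l := by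
  have hb : 0 < 1 / η := by positivity
  have h1 : ∀ z : ℂ, fRadial η l (‖z‖ ^ 2) * ‖coherentAmp z n‖ ^ 2 =
      ∑ q ∈ Finset.range (l + 1), (l.factorial : ℝ) * (-1) ^ q /
        (q.factorial * ((l - q).factorial : ℝ) ^ 2) / (η ^ (l + 1) * η ^ (l - q)) / n.factorial *
          ((‖z‖ ^ 2) ^ (n + (l - q)) * Real.exp (-(1 / η) * ‖z‖ ^ 2)) := fun z => by
    rw [norm_coherentAmp_sq, fRadial, Finset.sum_mul]
    refine Finset.sum_congr rfl fun q _ => ?_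
    rw [show -(1 / η) * ‖z‖ ^ 2 = (1 - 1 / η) * ‖z‖ ^ 2 + -‖z‖ ^ 2 by ring, Real.exp_add, pow_add]
    ring
  have hi : ∀ q ∈ Finset.range (l + 1), Integrable (fun z : ℂ => (l.factorial : ℝ) * (-1) ^ q /
        (q.factorial * ((l - q).factorial : ℝ) ^ 2) / (η ^ (l + 1) * η ^ (l - q)) / n.factorial *
          ((‖z‖ ^ 2) ^ (n + (l - q)) * Real.exp (-(1 / η) * ‖z‖ ^ 2))) modeMeasure := fun q _ =>
    (integral_pow_mul_exp_modeMeasure hb _).1.const_mul _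
  rw [modeMean]
  simp only [h1]
  refine ⟨integrable_finsetSum _ hi, ?_⟩
  rw [integral_finsetSum _ hi]
  have h2 : ∀ q ∈ Finset.range (l + 1), ∫ z : ℂ, (l.factorial : ℝ) * (-1) ^ q /
        (q.factorial * ((l - q).factorial : ℝ) ^ 2) / (η ^ (l + 1) * η ^ (l - q)) / n.factorial *
          ((‖z‖ ^ 2) ^ (n + (l - q)) * Real.exp (-(1 / η) * ‖z‖ ^ 2)) ∂modeMeasure =
      η ^ n / η ^ l * (((-1 : ℤ) ^ q * (l.choose q) * ((n + l - q).choose n) : ℤ) : ℝ) := by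
    intro q hq
    have hql : q ≤ l := by have := Finset.mem_range.1 hq; omega
    rw [integral_const_mul, (integral_pow_mul_exp_modeMeasure hb _).2]
    have hc1 : (l.choose q : ℝ) = l.factorial / (q.factorial * (l - q).factorial) :=
      Nat.cast_choose ℝ hql
    have hc2 : ((n + l - q).choose n : ℝ) =
        (n + (l - q)).factorial / (n.factorial * (l - q).factorial) := by
      rw [Nat.add_sub_assoc hql, Nat.cast_add_choose]
    push_cast
    rw [hc1, hc2, one_div, inv_pow, div_inv_eq_mul, pow_add η (n + (l - q)) 1, pow_add η n (l - q),
      pow_succ η l, pow_one]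
    field_simp
  rw [Finset.sum_congr rfl h2, ← Finset.mul_sum, ← Int.cast_sum]
  congr 1
  rw [sum_neg_one_pow_choose_mul_choose, Int.cast_natCast]

/-- Expected values of the estimator on Fock states. The alternating sum of binomial coefficients
that remains for `n > k` has the sign of `(-1)^(p-1)`: this is why `p` is even. -/
lemma modeMean_gEst (hη : 0 < η) {p : ℕ} (hp : 0 < p) (k n : ℕ) :
    modeMean (fun z => (gEst p k k z η).re) n =
      if n = k then 1 else if n < k then 0 else
        η ^ n / η ^ k * (n.choose k * ((-1) ^ (p - 1) * ((n - k - 1).choose (p - 1)))) := by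
  have h1 : modeMean (fun z => (gEst p k k z η).re) n =
      η ^ n / η ^ k * (n.choose k * ∑ j ∈ Finset.range p, (-1) ^ j * ((n - k).choose j : ℝ)) := by
    rw [modeMean]
    simp only [gEst_self_re hη, Finset.sum_mul, mul_assoc]
    rw [integral_finsetSum _ fun j _ => by
      simpa only [mul_assoc] using
        (((fRadial_mean hη (k + j) n).1.const_mul _).const_mul _).const_mul _]
    simp only [integral_const_mul]
    rw [Finset.mul_sum, Finset.mul_sum]
    refine Finset.sum_congr rfl fun j _ => ?_
    have h := (fRadial_mean hη (k + j) n).2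
    rw [modeMean] at h
    rw [h]
    have hc : ((k + j).choose k : ℝ) * n.choose (k + j) = n.choose k * (n - k).choose j := by
      rcases le_or_gt (k + j) n with hkn | hkn
      · have := Nat.choose_mul (n := n) (k := k + j) (s := k) (by omega)
        rw [Nat.add_sub_cancel_left] at this
        rw [mul_comm]; exact_mod_cast this
      · rw [Nat.choose_eq_zero_of_lt hkn]
        rcases le_or_gt k n with hk | hk
        · rw [Nat.choose_eq_zero_of_lt (by omega : n - k < j)]; simp
        · rw [Nat.choose_eq_zero_of_lt hk]; simp
    rw [pow_add η k j]
    field_simp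
    linear_combination hc
  rw [h1]
  obtain ⟨p, rfl⟩ : ∃ p', p = p' + 1 := ⟨p - 1, by omega⟩
  split_ifs with h2 h3
  · subst h2
    rw [Finset.sum_range_succ', Finset.sum_eq_zero fun j _ => by simp]
    simp [hη.ne']
  · rw [Nat.choose_eq_zero_of_lt h3]; simp
  · obtain ⟨r, hr⟩ : ∃ r, n - k = r + 1 := ⟨n - k - 1, by omega⟩
    have h := @Int.alternating_sum_range_choose_eq_choose r p
    have h' : ∑ j ∈ Finset.range (p + 1), (-1 : ℝ) ^ j * ((r + 1).choose j : ℝ) =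
        (-1) ^ p * (r.choose p : ℝ) := by exact_mod_cast h
    rw [hr, h']
    simp

lemma modeMean_gEst_le (hη : 0 < η) {p : ℕ} (hp : 0 < p) (hp' : Even p) (k n : ℕ) :
    modeMean (fun z => (gEst p k k z η).re) n ≤ if n = k then 1 else 0 := by
  rw [modeMean_gEst hη hp]
  split_ifs with h1 h2
  · rfl
  · rfl
  · obtain ⟨r, hr⟩ := hp'
    have ho : Odd (p - 1) := ⟨r - 1, by omega⟩
    rw [ho.neg_one_pow]
    have : 0 ≤ η ^ n / η ^ k * (n.choose k * ((n - k - 1).choose (p - 1) : ℝ)) := by positivity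
    linarith

end estimator

/-! ### Expected values of the estimates under heterodyne detection -/

lemma coherentAmp_orthogonal (a b : ℕ) :
    Integrable (fun z => coherentAmp z a * star (coherentAmp z b)) modeMeasure ∧
      ∫ z, coherentAmp z a * star (coherentAmp z b) ∂modeMeasure = if a = b then 1 else 0 := by
  simpa only [squeezedAmp_zero] using squeezedAmp_orthogonal 0 a b

lemma coherentAmp_mul {w : ℂ} (hw : ‖w‖ = 1) (z : ℂ) (a : ℕ) :
    coherentAmp (w * z) a = w ^ a * coherentAmp z a := by
  rw [coherentAmp, coherentAmp, norm_mul, hw, one_mul, mul_pow]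
  ring

lemma integral_comp_mul_modeMeasure {w : ℂ} (hw : ‖w‖ = 1) (F : ℂ → ℂ) :
    ∫ z, F (w * z) ∂modeMeasure = ∫ z, F z ∂modeMeasure := by
  set e : Circle := ⟨w, by simp [Submonoid.unitSphere, hw]⟩
  have hrot : MeasurePreserving (rotation e) := (rotation e).measurePreserving
  have hemb : MeasurableEmbedding (rotation e) := (rotation e).toHomeomorph.measurableEmbedding
  rw [integral_modeMeasure, integral_modeMeasure, ← hrot.integral_comp hemb F]
  rfl

/-- A bounded continuous function of the modulus, the kind of function that estimates the fidelity
of a mode with a Fock state. -/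
structure IsRadialEstimator (f : ℂ → ℝ) (B : ℝ) : Prop where
  continuous : Continuous f
  bound : ∀ z, |f z| ≤ B
  radial : ∀ w z : ℂ, ‖w‖ = 1 → f (w * z) = f z

section radial

variable {f : ℂ → ℝ} {B : ℝ}

lemma IsRadialEstimator.nonneg_bound (hf : IsRadialEstimator f B) : 0 ≤ B :=
  (abs_nonneg _).trans (hf.bound 0)

lemma IsRadialEstimator.add_const (hf : IsRadialEstimator f B) {c : ℝ} (hc : 0 ≤ c) :
    IsRadialEstimator (fun z => f z + c) (B + c) where
  continuous := hf.continuous.add continuous_const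
  bound z := (abs_add_le _ _).trans (by rw [abs_of_nonneg hc]; gcongr; exact hf.bound z)
  radial w z hw := by rw [hf.radial w z hw]

/-- Radial functions are diagonal in the Fock basis: a rotation of the phase space multiplies the
off-diagonal elements by a phase, which may be chosen to be `-1`. -/
lemma IsRadialEstimator.integral_coherentAmp (hf : IsRadialEstimator f B) (a b : ℕ) :
    Integrable (fun z => (f z : ℂ) * (coherentAmp z a * star (coherentAmp z b))) modeMeasure ∧
      ∫ z, (f z : ℂ) * (coherentAmp z a * star (coherentAmp z b)) ∂modeMeasure =
        if a = b then (modeMean f a : ℂ) else 0 := by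
  have hint : Integrable (fun z => (f z : ℂ) * (coherentAmp z a * star (coherentAmp z b)))
      modeMeasure := by
    refine (coherentAmp_orthogonal a b).1.bdd_mul (c := B)
      (Complex.continuous_ofReal.comp hf.continuous).aestronglyMeasurable
      (Filter.Eventually.of_forall fun z => ?_)
    rw [Complex.norm_real]; exact hf.bound z
  refine ⟨hint, ?_⟩
  split_ifs with hab
  · subst hab
    rw [modeMean, ← integral_complex_ofReal]
    refine integral_congr_ae (Filter.Eventually.of_forall fun z => ?_)
    simp only [Complex.star_def, Complex.mul_conj, Complex.normSq_eq_norm_sq]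
    push_cast; rfl
  · set t : ℝ := Real.pi / ((a : ℝ) - b) with ht
    have hab' : (a : ℝ) - b ≠ 0 := sub_ne_zero.2 (by exact_mod_cast hab)
    set w : ℂ := Complex.exp ((t : ℂ) * Complex.I) with hw
    have hw1 : ‖w‖ = 1 := Complex.norm_exp_ofReal_mul_I _
    have hphase : w ^ a * star w ^ b = -1 := by
      rw [Complex.star_def, hw, ← Complex.exp_conj, ← Complex.exp_nat_mul, ← Complex.exp_nat_mul,
        ← Complex.exp_add, ← Complex.exp_pi_mul_I]
      congr 1
      rw [map_mul, Complex.conj_ofReal, Complex.conj_I, ht]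
      have : ((a : ℂ) - b) ≠ 0 := by exact_mod_cast hab'
      push_cast
      field_simp
      ring
    have h := integral_comp_mul_modeMeasure hw1
      (fun z => (f z : ℂ) * (coherentAmp z a * star (coherentAmp z b)))
    have h2 : ∀ z, (f (w * z) : ℂ) * (coherentAmp (w * z) a * star (coherentAmp (w * z) b)) =
        -((f z : ℂ) * (coherentAmp z a * star (coherentAmp z b))) := fun z => by
      rw [hf.radial w z hw1, coherentAmp_mul hw1, coherentAmp_mul hw1, star_mul', star_pow]
      linear_combination ((f z : ℂ) * (coherentAmp z a * star (coherentAmp z b))) * hphase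
    simp only [h2, integral_neg] at h
    exact self_eq_neg.1 h.symm

lemma modeMean_const (c : ℝ) (n : ℕ) : modeMean (fun _ => c) n = c := by
  have hf : IsRadialEstimator (fun _ => (1 : ℝ)) 1 := ⟨continuous_const, by simp, by simp⟩
  have h := (hf.integral_coherentAmp n n).2
  simp only [if_true, Complex.ofReal_one, one_mul, (coherentAmp_orthogonal n n).2] at h
  have h1 : modeMean (fun _ => (1 : ℝ)) n = 1 := by exact_mod_cast h.symm
  simp only [modeMean, one_mul] at h1
  rw [modeMean, integral_const_mul, h1, mul_one]

lemma IsRadialEstimator.integrable_modeMean (hf : IsRadialEstimator f B) (n : ℕ) :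
    Integrable (fun z => f z * ‖coherentAmp z n‖ ^ 2) modeMeasure := by
  have h := (hf.integral_coherentAmp n n).1.re
  refine h.congr (Filter.Eventually.of_forall fun z => ?_)
  simp only [Complex.star_def, Complex.mul_conj, Complex.normSq_eq_norm_sq]
  rw [← Complex.ofReal_mul]
  exact Complex.ofReal_re _

lemma IsRadialEstimator.modeMean_add_const (hf : IsRadialEstimator f B) (c : ℝ) (n : ℕ) :
    modeMean (fun z => f z + c) n = modeMean f n + c := by
  have h1 : IsRadialEstimator (fun _ => c) |c| := ⟨continuous_const, by simp, by simp⟩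
  have h2 := modeMean_const c n
  simp only [modeMean, add_mul] at h2 ⊢
  rw [integral_add (hf.integrable_modeMean n) (h1.integrable_modeMean n), h2]

variable {m : ℕ}

/-- A radial function of one mode is diagonal in the Fock basis. -/
lemma IsRadialEstimator.integral_coherentState (hf : IsRadialEstimator f B) (i : Fin m)
    (k l : Fin m → ℕ) :
    Integrable (fun α => (f (α i) : ℂ) * (coherentState α k * star (coherentState α l)))
      (phaseMeasure m) ∧
      ∫ α, (f (α i) : ℂ) * (coherentState α k * star (coherentState α l)) ∂(phaseMeasure m) =
        if k = l then (modeMean f (k i) : ℂ) else 0 := by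
  set F : Fin m → ℂ → ℂ := fun j z => (if j = i then (f z : ℂ) else 1) *
    (coherentAmp z (k j) * star (coherentAmp z (l j))) with hF
  have hprod : ∀ α : Fin m → ℂ, (f (α i) : ℂ) * (coherentState α k * star (coherentState α l)) =
      ∏ j, F j (α j) := fun α => by
    simp only [hF]
    rw [Finset.prod_mul_distrib, Finset.prod_ite_eq' Finset.univ i, if_pos (Finset.mem_univ i),
      Finset.prod_mul_distrib]
    change _ * ((∏ j, coherentAmp (α j) (k j)) * star (∏ j, coherentAmp (α j) (l j))) = _
    rw [Complex.star_def, map_prod]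
  have hmode : ∀ j, Integrable (F j) modeMeasure ∧ ∫ z, F j z ∂modeMeasure =
      if k j = l j then (if j = i then (modeMean f (k i) : ℂ) else 1) else 0 := by
    intro j
    by_cases hj : j = i
    · subst hj
      simp only [hF, if_true]
      exact hf.integral_coherentAmp _ _
    · simp only [hF, if_neg hj, one_mul]
      exact coherentAmp_orthogonal _ _
  simp only [hprod]
  refine ⟨integrable_phaseMeasure_prod fun j => (hmode j).1, ?_⟩
  rw [integral_phaseMeasure_prod F]
  simp only [(hmode _).2]
  rw [Finset.prod_ite_zero, Finset.prod_ite_eq' Finset.univ i]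
  simp [funext_iff]

lemma inner_coherentState_sum_fockState (s : Finset (Fin m → ℕ)) (φ : FockSpace m)
    (α : Fin m → ℂ) :
    inner ℂ (coherentState α) (∑ l ∈ s, φ l • fockState l) =
      ∑ l ∈ s, φ l * star (coherentState α l) := by
  rw [inner_sum]
  refine Finset.sum_congr rfl fun l _ => ?_
  rw [inner_smul_right, ← inner_conj_symm, inner_fockState]; rfl

/-- The expected value of a nonnegative radial function of one mode over the Husimi function of a
pure state, bounded by its diagonal elements; by Fatou's lemma, finite superpositions suffice. -/
lemma IsRadialEstimator.lintegral_pure_le (hf : IsRadialEstimator f B) (h0 : ∀ z, 0 ≤ f z)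
    (i : Fin m) (φ : FockSpace m) :
    ∫⁻ α, ENNReal.ofReal (f (α i)) * ‖inner ℂ (coherentState α) φ‖ₑ ^ 2 ∂(phaseMeasure m) ≤
      ∑' l : Fin m → ℕ, ENNReal.ofReal (modeMean f (l i)) * ‖φ l‖ₑ ^ 2 := by
  have hfin : ∀ s : Finset (Fin m → ℕ),
      ∫⁻ α, ENNReal.ofReal (f (α i)) *
        ‖inner ℂ (coherentState α) (∑ l ∈ s, φ l • fockState l)‖ₑ ^ 2 ∂(phaseMeasure m) =
      ∑ l ∈ s, ENNReal.ofReal (modeMean f (l i)) * ‖φ l‖ₑ ^ 2 := by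
    intro s
    have hexp : ∀ α : Fin m → ℂ, ((f (α i) *
        ‖inner ℂ (coherentState α) (∑ l ∈ s, φ l • fockState l)‖ ^ 2 : ℝ) : ℂ) =
        ∑ l ∈ s, ∑ k ∈ s, (φ l * star (φ k)) *
          ((f (α i) : ℂ) * (coherentState α k * star (coherentState α l))) := by
      intro α
      rw [Complex.ofReal_mul, ← Complex.normSq_eq_norm_sq, ← Complex.mul_conj,
        inner_coherentState_sum_fockState, map_sum, Finset.sum_mul_sum, Finset.mul_sum]
      refine Finset.sum_congr rfl fun l _ => ?_
      rw [Finset.mul_sum]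
      refine Finset.sum_congr rfl fun k _ => ?_
      simp only [map_mul, Complex.star_def, Complex.conj_conj]
      ring
    have hint : ∀ l k : Fin m → ℕ, Integrable (fun α : Fin m → ℂ => (φ l * star (φ k)) *
          ((f (α i) : ℂ) * (coherentState α k * star (coherentState α l)))) (phaseMeasure m) :=
      fun l k => (hf.integral_coherentState i k l).1.const_mul _
    have hI : Integrable (fun α : Fin m → ℂ => ((f (α i) *
        ‖inner ℂ (coherentState α) (∑ l ∈ s, φ l • fockState l)‖ ^ 2 : ℝ) : ℂ))
        (phaseMeasure m) := by
      simp only [hexp]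
      exact integrable_finsetSum _ fun l _ => integrable_finsetSum _ fun k _ => hint l k
    have hval : ∫ α : Fin m → ℂ, f (α i) *
        ‖inner ℂ (coherentState α) (∑ l ∈ s, φ l • fockState l)‖ ^ 2 ∂(phaseMeasure m) =
        ∑ l ∈ s, modeMean f (l i) * ‖φ l‖ ^ 2 := by
      apply Complex.ofReal_injective
      rw [← integral_complex_ofReal]
      simp only [hexp]
      rw [integral_finsetSum _ fun l _ => integrable_finsetSum _ fun k _ => hint l k,
        Complex.ofReal_sum]
      refine Finset.sum_congr rfl fun l hl => ?_
      rw [integral_finsetSum _ fun k _ => hint l k]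
      simp only [integral_const_mul, (hf.integral_coherentState i _ _).2, mul_ite, mul_zero]
      rw [Finset.sum_ite_eq' s l, if_pos hl, Complex.star_def, Complex.mul_conj,
        Complex.normSq_eq_norm_sq]
      push_cast; ring
    have hmm : ∀ n, 0 ≤ modeMean f n := fun n =>
      integral_nonneg fun z => mul_nonneg (h0 z) (by positivity)
    have h1 := ofReal_integral_eq_lintegral_ofReal (f := fun α : Fin m → ℂ => f (α i) *
      ‖inner ℂ (coherentState α) (∑ l ∈ s, φ l • fockState l)‖ ^ 2) hI.re
      (Filter.Eventually.of_forall fun α => mul_nonneg (h0 _) (by positivity))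
    rw [hval, ENNReal.ofReal_sum_of_nonneg fun l _ => mul_nonneg (hmm _) (by positivity)] at h1
    simp only [ENNReal.ofReal_mul (h0 _), ENNReal.ofReal_mul (hmm _),
      ENNReal.ofReal_pow (norm_nonneg _), ofReal_norm] at h1
    exact h1.symm
  obtain ⟨s, hs⟩ := Filter.exists_seq_tendsto (Filter.atTop : Filter (Finset (Fin m → ℕ)))
  have hφ : Filter.Tendsto (fun n => ∑ l ∈ s n, φ l • fockState l) Filter.atTop (nhds φ) := by
    have h := (lp.hasSum_single (p := 2) (by norm_num) φ).comp hs
    refine h.congr fun n => Finset.sum_congr rfl fun l _ => ?_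
    rw [fockState, ← lp.single_smul, smul_eq_mul, mul_one]
  have hmeas : ∀ χ : FockSpace m, Measurable fun α : Fin m → ℂ =>
      ENNReal.ofReal (f (α i)) * ‖inner ℂ (coherentState α) χ‖ₑ ^ 2 := fun χ =>
    (hf.continuous.measurable.comp (measurable_pi_apply i)).ennreal_ofReal.mul
      (((resolvesIdentity_coherentState m).measurable_inner χ).enorm.pow_const _)
  calc ∫⁻ α, ENNReal.ofReal (f (α i)) * ‖inner ℂ (coherentState α) φ‖ₑ ^ 2 ∂(phaseMeasure m)
      = ∫⁻ α, Filter.liminf (fun n => ENNReal.ofReal (f (α i)) *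
          ‖inner ℂ (coherentState α) (∑ l ∈ s n, φ l • fockState l)‖ₑ ^ 2) Filter.atTop
            ∂(phaseMeasure m) := by
        refine lintegral_congr fun α => (Filter.Tendsto.liminf_eq ?_).symm
        refine ENNReal.Tendsto.const_mul ?_ (Or.inr ENNReal.ofReal_ne_top)
        exact ((ENNReal.continuous_pow 2).tendsto _).comp (tendsto_const_nhds.inner hφ).enorm
    _ ≤ Filter.liminf (fun n => ∫⁻ α, ENNReal.ofReal (f (α i)) *
          ‖inner ℂ (coherentState α) (∑ l ∈ s n, φ l • fockState l)‖ₑ ^ 2 ∂(phaseMeasure m))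
            Filter.atTop := lintegral_liminf_le fun n => hmeas _
    _ ≤ ∑' l : Fin m → ℕ, ENNReal.ofReal (modeMean f (l i)) * ‖φ l‖ₑ ^ 2 := by
        simp only [hfin]
        refine Filter.liminf_le_of_le (by isBoundedDefault) fun b hb => ?_
        obtain ⟨n, hn⟩ := hb.exists
        exact hn.trans (ENNReal.sum_le_tsum _)

variable {U : Matrix (Fin m) (Fin m) ℂ} {ρ : FockSpace m →L[ℂ] FockSpace m}

lemma passiveIsometry_fockState (hU : U ∈ Matrix.unitaryGroup (Fin m) ℂ) (l : Fin m → ℕ) :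
    passiveIsometry hU (fockState l) = rotatedFock U l := by
  refine (hasSum_passiveIsometry hU (fockState l)).unique ?_
  have h := hasSum_ite_eq l (rotatedFock U l)
  refine (congrArg (fun F => HasSum F (rotatedFock U l)) (funext fun k => ?_)).mpr h
  rw [fockState_apply]
  split_ifs with hk
  · rw [hk, one_smul]
  · rw [zero_smul]

lemma lintegral_heterodyne (hρ : IsDensity ρ) {G : (Fin m → ℂ) → ℝ≥0∞} (hG : Measurable G) :
    ∫⁻ γ, G γ ∂(heterodyne ρ) =
      ∫⁻ γ, ENNReal.ofReal (weight ρ (coherentState γ)) * G γ ∂(phaseMeasure m) := by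
  rw [heterodyne_eq_outcome, outcome, lintegral_withDensity_eq_lintegral_mul _
    ((resolvesIdentity_coherentState m).measurable_weight hρ).ennreal_ofReal hG]
  rfl

/-- The expected value of a nonnegative radial function of the mode `i` of `U†γ`, bounded by its
diagonal elements. -/
lemma IsRadialEstimator.lintegral_heterodyne_le (hf : IsRadialEstimator f B) (h0 : ∀ z, 0 ≤ f z)
    (hU : U ∈ Matrix.unitaryGroup (Fin m) ℂ) (hρ : IsDensity ρ) (i : Fin m) :
    ∫⁻ γ, ENNReal.ofReal (f ((Uᴴ *ᵥ γ) i)) ∂(heterodyne ρ) ≤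
      ∫⁻ l, ENNReal.ofReal (modeMean f (l i)) ∂(outcome Measure.count (rotatedFock U) ρ) := by
  obtain ⟨T, hT, hρT⟩ := exists_sqrt_of_isPositive hρ.1
  have hmp := measurePreserving_conjTranspose_mulVec hU
  have hr := resolvesIdentity_coherentState m
  have hfm : Measurable fun α : Fin m → ℂ => ENNReal.ofReal (f (α i)) :=
    (hf.continuous.measurable.comp (measurable_pi_apply i)).ennreal_ofReal
  set V := (passiveIsometry hU).toContinuousLinearMap with hV
  -- the vectors `Û† √ρ |k⟩`
  set χ : (Fin m → ℕ) → FockSpace m := fun k => V.adjoint (T (fockState k)) with hχ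
  have hχi : ∀ k γ, inner ℂ (coherentState γ) (T (fockState k)) =
      inner ℂ (coherentState (Uᴴ *ᵥ γ)) (χ k) := fun k γ => by
    rw [hχ, ContinuousLinearMap.adjoint_inner_right, hV]
    exact congrArg (fun u => inner ℂ u (T (fockState k))) (passiveIsometry_coherentState hU γ).symm
  have hχl : ∀ k l, χ k l = inner ℂ (rotatedFock U l) (T (fockState k)) := fun k l => by
    rw [← inner_fockState l (χ k), hχ, ContinuousLinearMap.adjoint_inner_right, hV]
    exact congrArg (fun u => inner ℂ u (T (fockState k))) (passiveIsometry_fockState hU l)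
  calc ∫⁻ γ, ENNReal.ofReal (f ((Uᴴ *ᵥ γ) i)) ∂(heterodyne ρ)
      = ∫⁻ γ, ∑' k, ENNReal.ofReal (f ((Uᴴ *ᵥ γ) i)) *
          ‖inner ℂ (coherentState (Uᴴ *ᵥ γ)) (χ k)‖ₑ ^ 2 ∂(phaseMeasure m) := by
        refine (lintegral_heterodyne hρ (hfm.comp hmp.measurable)).trans ?_
        refine lintegral_congr fun γ => ?_
        rw [ofReal_weight_eq_tsum hT hρT, ENNReal.tsum_mul_left, mul_comm, Function.comp_apply]
        simp only [hχi]
    _ = ∫⁻ α, ∑' k, ENNReal.ofReal (f (α i)) *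
          ‖inner ℂ (coherentState α) (χ k)‖ₑ ^ 2 ∂(phaseMeasure m) :=
        hmp.lintegral_comp (f := fun α => ∑' k, ENNReal.ofReal (f (α i)) *
          ‖inner ℂ (coherentState α) (χ k)‖ₑ ^ 2)
          (Measurable.tsum fun k => hfm.mul ((hr.measurable_inner _).enorm.pow_const _))
    _ = ∑' k, ∫⁻ α, ENNReal.ofReal (f (α i)) *
          ‖inner ℂ (coherentState α) (χ k)‖ₑ ^ 2 ∂(phaseMeasure m) :=
        lintegral_tsum fun k => (hfm.mul ((hr.measurable_inner _).enorm.pow_const _)).aemeasurable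
    _ ≤ ∑' k, ∑' l : Fin m → ℕ, ENNReal.ofReal (modeMean f (l i)) * ‖χ k l‖ₑ ^ 2 :=
        ENNReal.tsum_le_tsum fun k => hf.lintegral_pure_le h0 i (χ k)
    _ = ∑' l : Fin m → ℕ, ENNReal.ofReal (modeMean f (l i)) *
          ENNReal.ofReal (weight ρ (rotatedFock U l)) := by
        rw [ENNReal.tsum_comm]
        refine tsum_congr fun l => ?_
        rw [ENNReal.tsum_mul_left, ofReal_weight_eq_tsum hT hρT]
        simp only [hχl]
    _ = _ := by
        rw [outcome, lintegral_withDensity_eq_lintegral_mul _ (measurable_of_countable _)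
          (measurable_of_countable _), lintegral_count]
        exact tsum_congr fun l => mul_comm _ _

lemma IsRadialEstimator.measurable_comp (hf : IsRadialEstimator f B)
    (U : Matrix (Fin m) (Fin m) ℂ) (i : Fin m) :
    Measurable fun γ : Fin m → ℂ => f ((Uᴴ *ᵥ γ) i) := by
  have h : Continuous fun γ : Fin m → ℂ => Uᴴ *ᵥ γ :=
    Continuous.matrix_mulVec continuous_const continuous_id
  exact (hf.continuous.comp ((continuous_apply i).comp h)).measurable

/-- The estimate of the fidelity of a mode never exceeds the fidelity, in expectation, when the
estimator has nonpositive mean on the other Fock states. -/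
theorem IsRadialEstimator.integral_heterodyne_le (hf : IsRadialEstimator f B) {k : ℕ}
    (hk : ∀ n, modeMean f n ≤ if n = k then 1 else 0)
    (hU : U ∈ Matrix.unitaryGroup (Fin m) ℂ) (hρ : IsDensity ρ) (i : Fin m) :
    ∫ γ, f ((Uᴴ *ᵥ γ) i) ∂(heterodyne ρ) ≤ modeFidelity U ρ i k := by
  have hB := hf.nonneg_bound
  have hP1 : IsProbabilityMeasure (heterodyne ρ) := by
    rw [heterodyne_eq_outcome]
    exact (resolvesIdentity_coherentState m).isProbabilityMeasure_outcome hρ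
  have hP2 := (resolvesIdentity_rotatedFock hU).isProbabilityMeasure_outcome hρ
  set μ := outcome Measure.count (rotatedFock U) ρ
  have hS : MeasurableSet {l : Fin m → ℕ | l i = k} := (Set.to_countable _).measurableSet
  -- adding the bound `B` makes the estimator nonnegative, as needed for Fatou's lemma
  have h0 : ∀ z, 0 ≤ f z + B := fun z => by linarith [(abs_le.1 (hf.bound z)).1]
  have hle : ∫⁻ γ, ENNReal.ofReal (f ((Uᴴ *ᵥ γ) i) + B) ∂(heterodyne ρ) ≤
      ENNReal.ofReal (B + modeFidelity U ρ i k) := by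
    calc _ ≤ ∫⁻ l, ENNReal.ofReal (modeMean (fun z => f z + B) (l i)) ∂μ :=
          (hf.add_const hB).lintegral_heterodyne_le h0 hU hρ i
      _ ≤ ∫⁻ l, (ENNReal.ofReal B + {l : Fin m → ℕ | l i = k}.indicator 1 l) ∂μ := by
          refine lintegral_mono fun l => ?_
          rw [hf.modeMean_add_const]
          by_cases hl : l i = k
          · rw [Set.indicator_of_mem (show l ∈ {l : Fin m → ℕ | l i = k} from hl), Pi.one_apply,
              ← ENNReal.ofReal_one, ← ENNReal.ofReal_add hB zero_le_one]
            refine ENNReal.ofReal_le_ofReal ?_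
            have := hk (l i)
            rw [if_pos hl] at this
            linarith
          · rw [Set.indicator_of_notMem (show l ∉ {l : Fin m → ℕ | l i = k} from hl), add_zero]
            refine ENNReal.ofReal_le_ofReal ?_
            have := hk (l i)
            rw [if_neg hl] at this
            linarith
      _ = _ := by
          rw [lintegral_add_left measurable_const, lintegral_indicator_one hS, lintegral_const,
            measure_univ, mul_one, modeFidelity, ENNReal.ofReal_add hB measureReal_nonneg,
            ofReal_measureReal]
  have hint : Integrable (fun γ => f ((Uᴴ *ᵥ γ) i)) (heterodyne ρ) :=
    Integrable.of_bound (hf.measurable_comp U i).aestronglyMeasurable B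
      (Filter.Eventually.of_forall fun γ => hf.bound _)
  have h1 : ∫ γ, (f ((Uᴴ *ᵥ γ) i) + B) ∂(heterodyne ρ) ≤ B + modeFidelity U ρ i k := by
    rw [integral_eq_lintegral_of_nonneg_ae (Filter.Eventually.of_forall fun γ => h0 _)
      (hint.add (integrable_const B)).1]
    exact ENNReal.toReal_le_of_le_ofReal (add_nonneg hB measureReal_nonneg) hle
  rw [integral_add hint (integrable_const B), integral_const, probReal_univ, one_smul] at h1
  linarith

/-- The estimate is unbiased in the rotated Fock states. -/
theorem IsRadialEstimator.integral_heterodyne_rotatedFock (hf : IsRadialEstimator f B)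
    (hU : U ∈ Matrix.unitaryGroup (Fin m) ℂ) (k : Fin m → ℕ) (i : Fin m) :
    ∫ γ, f ((Uᴴ *ᵥ γ) i) ∂(heterodyne (pureState (rotatedFock U k))) = modeMean f (k i) := by
  have hr := resolvesIdentity_coherentState m
  have hd := isDensity_pureState ((orthonormal_rotatedFock hU).1 k)
  have hmp := measurePreserving_conjTranspose_mulVec hU
  rw [heterodyne_eq_outcome, outcome, integral_withDensity_eq_integral_toReal_smul
    (hr.measurable_weight hd).ennreal_ofReal
    (Filter.Eventually.of_forall fun _ => ENNReal.ofReal_lt_top)]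
  have h := (hf.integral_coherentState i k k).2
  rw [if_pos rfl] at h
  simp only [Complex.star_def, Complex.mul_conj, Complex.normSq_eq_norm_sq,
    ← Complex.ofReal_mul] at h
  rw [integral_complex_ofReal] at h
  rw [← Complex.ofReal_injective h]
  have hmeas : Measurable fun α : Fin m → ℂ => f (α i) * ‖coherentState α k‖ ^ 2 :=
    (hf.continuous.measurable.comp (measurable_pi_apply i)).mul
      ((measurable_coherentState_apply k).norm.pow_const 2)
  conv_rhs => rw [← hmp.map_eq]
  rw [integral_map (φ := fun γ => Uᴴ *ᵥ γ) hmp.measurable.aemeasurable hmeas.aestronglyMeasurable]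
  refine integral_congr_ae (Filter.Eventually.of_forall fun γ => ?_)
  simp only
  rw [ENNReal.toReal_ofReal (hd.weight_nonneg _), weight_pureState, ← inner_conj_symm,
    inner_rotatedFock_coherentState hU, RCLike.norm_conj, smul_eq_mul, mul_comm]

end radial

/-! ### Concentration of the estimates -/

/-- Hoeffding's inequality for the mean of independent samples. -/
lemma hoeffding_iid {Ω : Type*} [MeasurableSpace Ω] (P : Measure Ω) [IsProbabilityMeasure P]
    {X : Ω → ℝ} (hX : Measurable X) {B : ℝ} (hB : 0 < B) (hXB : ∀ ω, |X ω| ≤ B) {N : ℕ}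
    (hN : 1 ≤ N) {t : ℝ} (ht : 0 ≤ t) :
    (iid N P).real {γ | ∫ ω, X ω ∂P + t ≤ (∑ k, X (γ k)) / N} ≤
      Real.exp (-(N * t ^ 2 / (2 * B ^ 2))) := by
  have hNpos : (0 : ℝ) < N := by exact_mod_cast hN
  have hmean : ∀ k : Fin N, ∫ γ, X (γ k) ∂(iid N P) = ∫ ω, X ω ∂P := fun k =>
    integral_comp_eval (μ := fun _ : Fin N => P) hX.aestronglyMeasurable
  have : IsProbabilityMeasure (iid N P) := by unfold iid; infer_instance
  have hsub : ∀ k ∈ (Finset.univ : Finset (Fin N)), ProbabilityTheory.HasSubgaussianMGF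
      (fun γ : Fin N → Ω => X (γ k) - ∫ ω, X ω ∂P) ((‖B - -B‖₊ / 2) ^ 2) (iid N P) := by
    intro k _
    have h := ProbabilityTheory.hasSubgaussianMGF_of_mem_Icc (μ := iid N P)
      (X := fun γ => X (γ k)) (a := -B) (b := B)
      (hX.comp (measurable_pi_apply k)).aemeasurable
      (Filter.Eventually.of_forall fun γ => abs_le.1 (hXB (γ k)))
    rwa [hmean k] at h
  have hind : ProbabilityTheory.iIndepFun
      (fun (k : Fin N) (γ : Fin N → Ω) => X (γ k) - ∫ ω, X ω ∂P) (iid N P) :=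
    ProbabilityTheory.iIndepFun_pi (μ := fun _ : Fin N => P)
      (X := fun _ ω => X ω - ∫ ω, X ω ∂P) fun _ => (hX.sub_const _).aemeasurable
  have h := ProbabilityTheory.HasSubgaussianMGF.measure_sum_ge_le_of_iIndepFun hind hsub
    (ε := N * t) (by positivity)
  have hset : {γ : Fin N → Ω | ∫ ω, X ω ∂P + t ≤ (∑ k, X (γ k)) / N} =
      {γ | N * t ≤ ∑ k, (X (γ k) - ∫ ω, X ω ∂P)} := by
    ext γ
    simp only [Set.mem_ofPred_eq, Finset.sum_sub_distrib, Finset.sum_const, Finset.card_univ,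
      Fintype.card_fin, nsmul_eq_mul]
    rw [le_div_iff₀ hNpos, le_sub_iff_add_le]
    constructor <;> intro h <;> linarith
  rw [hset]
  refine h.trans (le_of_eq ?_)
  congr 1
  have hn : ‖B - -B‖ = 2 * B := by rw [sub_neg_eq_add, ← two_mul, Real.norm_of_nonneg (by linarith)]
  simp only [Finset.sum_const, Finset.card_univ, Fintype.card_fin, nsmul_eq_mul, NNReal.coe_mul,
    NNReal.coe_natCast, NNReal.coe_pow, NNReal.coe_div, coe_nnnorm, NNReal.coe_ofNat, hn]
  field_simp

/-- Simultaneous deviations of `m` estimates. -/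
lemma measureReal_exists_deviation_le {Ω : Type*} [MeasurableSpace Ω] (P : Measure Ω)
    [IsProbabilityMeasure P] {m : ℕ} {X : Fin m → Ω → ℝ} (hX : ∀ i, Measurable (X i)) {B : ℝ}
    (hB : 0 < B) (hXB : ∀ i ω, |X i ω| ≤ B) {N : ℕ} (hN : 1 ≤ N) {t : ℝ} (ht : 0 ≤ t) :
    (iid N P).real {γ | ∃ i, ∫ ω, X i ω ∂P + t ≤ (∑ k, X i (γ k)) / N} ≤
      m * Real.exp (-(N * t ^ 2 / (2 * B ^ 2))) := by
  rw [Set.ofPred_exists]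
  refine (measureReal_iUnion_fintype_le _).trans ?_
  refine (Finset.sum_le_sum fun i _ => hoeffding_iid P (hX i) hB (hXB i) hN ht).trans ?_
  simp

/-- The number of samples that makes the union bound over `m` modes smaller than `δ`. -/
lemma card_mul_exp_le {m M N : ℕ} {B e δ : ℝ} (hm : 1 ≤ m) (hM : 1 ≤ M) (hB : 0 < B) (he : 0 < e)
    (hδ : 0 < δ)
    (hN : 64 * B ^ 2 * (M * m / e) ^ 2 * max 1 (Real.log m) * max 1 (Real.log (1 / δ)) ≤ N) :
    m * Real.exp (-(N * (e / (4 * (M * m))) ^ 2 / (2 * B ^ 2))) ≤ δ := by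
  have hm0 : (0 : ℝ) < m := by exact_mod_cast hm
  have hM0 : (0 : ℝ) < M := by exact_mod_cast hM
  set a := max 1 (Real.log m)
  set b := max 1 (Real.log (1 / δ))
  have ha1 : 1 ≤ a := le_max_left _ _
  have hb1 : 1 ≤ b := le_max_left _ _
  have hab : Real.log m + Real.log (1 / δ) ≤ 2 * (a * b) := by
    have h1 : Real.log m ≤ a := le_max_right _ _
    have h2 : Real.log (1 / δ) ≤ b := le_max_right _ _
    nlinarith [mul_nonneg (sub_nonneg.2 ha1) (sub_nonneg.2 hb1)]
  have hexp : Real.log m + Real.log (1 / δ) ≤ N * (e / (4 * (M * m))) ^ 2 / (2 * B ^ 2) := by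
    refine hab.trans ?_
    have h := mul_le_mul_of_nonneg_right hN
      (by positivity : 0 ≤ (e / (4 * (M * m))) ^ 2 / (2 * B ^ 2))
    have h2 : 64 * B ^ 2 * (M * m / e) ^ 2 * a * b * ((e / (4 * (M * m))) ^ 2 / (2 * B ^ 2)) =
        2 * (a * b) := by
      field_simp
      norm_num
    rw [h2] at h
    rwa [mul_div_assoc]
  calc m * Real.exp (-(N * (e / (4 * (M * m))) ^ 2 / (2 * B ^ 2)))
      ≤ m * Real.exp (-(Real.log m + Real.log (1 / δ))) := by gcongr
    _ = δ := by
        rw [neg_add, Real.exp_add, Real.exp_neg, Real.exp_log hm0, one_div, Real.log_inv, neg_neg,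
          Real.exp_log hδ]
        field_simp

lemma le_measureReal_of_compl_le {Ω : Type*} [MeasurableSpace Ω] {P : Measure Ω}
    [IsProbabilityMeasure P] {bad good : Set Ω} {δ : ℝ} (hbad : P.real bad ≤ δ)
    (h : ∀ ω, ω ∉ bad → ω ∈ good) : 1 - δ ≤ P.real good := by
  have h1 : P.real Set.univ ≤ P.real (bad ∪ good) :=
    measureReal_mono fun ω _ => (em (ω ∈ bad)).imp id (h ω)
  rw [probReal_univ] at h1
  linarith [measureReal_union_le (μ := P) bad good]

/-! ### Powers of the estimates -/

lemma pow_le_pow_add {φ y s : ℝ} (hφ : 0 ≤ φ) (hφy : φ ≤ y) (hys : y ≤ s) (M : ℕ) :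
    y ^ M ≤ φ ^ M + M * (y - φ) * s ^ (M - 1) := by
  have h := (le_abs_self _).trans (abs_pow_sub_pow_le y φ M)
  rw [abs_of_nonneg (sub_nonneg.2 hφy), abs_of_nonneg (hφ.trans hφy), abs_of_nonneg hφ,
    max_eq_left hφy] at h
  have h2 : y ^ (M - 1) ≤ s ^ (M - 1) := pow_le_pow_left₀ (hφ.trans hφy) hys _
  have h3 : (y - φ) * M * y ^ (M - 1) ≤ (y - φ) * M * s ^ (M - 1) :=
    mul_le_mul_of_nonneg_left h2 (mul_nonneg (sub_nonneg.2 hφy) (Nat.cast_nonneg _))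
  linarith

/-- An overestimate by `t` of a fidelity changes its `M`-th power by at most `3 M t`. -/
lemma truncation_pow_le {τ : ℝ → ℝ} {M : ℕ} {φ x t : ℝ} (hφ : 0 ≤ φ) (hφ1 : φ ≤ 1) (ht : 0 ≤ t)
    (hx : x ≤ φ + t) (hτ : τ = truncate ∨ τ = id ∧ Odd M ∧ M * t ≤ 1) :
    τ x ^ M ≤ φ ^ M + 3 * (M * t) := by
  have hMt : 0 ≤ M * t := by positivity
  rcases hτ with rfl | ⟨rfl, hodd, hMt1⟩
  · have hy0 : 0 ≤ truncate x := le_max_left _ _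
    have hy1 : truncate x ≤ 1 := max_le zero_le_one (min_le_left _ _)
    have hyx : truncate x ≤ φ + t := max_le (by linarith) ((min_le_right _ _).trans hx)
    rcases le_total (truncate x) φ with h | h
    · linarith [pow_le_pow_left₀ hy0 h M]
    · have h1 := pow_le_pow_add hφ h hy1 M
      rw [one_pow, mul_one] at h1
      have h2 : M * (truncate x - φ) ≤ M * t := by gcongr; linarith
      linarith
  · have h1 : x ^ M ≤ (φ + t) ^ M := hodd.strictMono_pow.monotone hx
    have h2 := pow_le_pow_add hφ (by linarith : φ ≤ φ + t) (by linarith : φ + t ≤ 1 + t) M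
    have h3 : (1 + t) ^ (M - 1) ≤ 3 := by
      calc (1 + t) ^ (M - 1) ≤ (1 + t) ^ M := pow_le_pow_right₀ (by linarith) (Nat.sub_le _ _)
        _ ≤ Real.exp t ^ M := by
            gcongr; linarith [Real.add_one_le_exp t]
        _ = Real.exp (M * t) := (Real.exp_nat_mul _ _).symm
        _ ≤ Real.exp 1 := by gcongr
        _ ≤ 3 := Real.exp_one_lt_three.le
    rw [add_sub_cancel_left] at h2
    have h4 := mul_le_mul_of_nonneg_left h3 hMt
    simp only [id]
    linarith

/-- Bernoulli's inequality for the estimate of a fidelity equal to `1`. -/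
lemma le_truncation_pow {τ : ℝ → ℝ} {M : ℕ} {x t : ℝ} (hM : 1 ≤ M) (ht : 0 ≤ t)
    (hx : 1 - t ≤ x) (hτ : τ = truncate ∨ τ = id ∧ Odd M ∧ M * t ≤ 1) :
    1 - M * t ≤ τ x ^ M := by
  have hM1 : (1 : ℝ) ≤ M := by exact_mod_cast hM
  have hb : ∀ y : ℝ, t ≤ 1 → 1 - t ≤ y → 1 - M * t ≤ y ^ M := fun y ht1 hy => by
    have h1 := one_add_mul_le_pow (by linarith : -2 ≤ -t) M
    have h2 : (1 + -t) ^ M ≤ y ^ M := pow_le_pow_left₀ (by linarith) (by linarith) M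
    linarith
  rcases hτ with rfl | ⟨rfl, -, hMt1⟩
  · rcases le_or_gt t 1 with ht1 | ht1
    · exact hb _ ht1 (le_max_of_le_right (le_min (by linarith) hx))
    · have : 0 ≤ truncate x ^ M := pow_nonneg (le_max_left _ _) M
      nlinarith
  · exact hb x (by nlinarith) hx

/-! ### Soundness and completeness of the protocol -/

lemma isRadialEstimator_gEst {η : ℝ} (hη : 0 < η) {p k : ℕ} {B : ℝ}
    (hB : ∀ z, |(gEst p k k z η).re| ≤ B) :
    IsRadialEstimator (fun z => (gEst p k k z η).re) B where
  continuous := continuous_gEst_re hη p k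
  bound := hB
  radial w z hw := by simp only [gEst_self_re hη, norm_mul, hw, one_mul]

section protocol

variable {p m n M N : ℕ} {η B lam ε δ : ℝ} {U : Matrix (Fin m) (Fin m) ℂ} {τ : ℝ → ℝ}

/-- Unless an estimate exceeds its mean by `t`, which Hoeffding's inequality makes unlikely,
acceptance gives `∑ᵢ (1 - φᵢ^M) < lam`, and the samples are close to the ideal ones. -/
theorem soundness (hη : 0 < η) (hp : 0 < p) (hp' : Even p) (hB : 0 < B)
    (hgB : ∀ i z, |(gEst p (inputPattern m n i) (inputPattern m n i) z η).re| ≤ B)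
    (hm : 1 ≤ m) (hM : 1 ≤ M) (hN1 : 1 ≤ N) (hε : 0 < ε) (hεl : ε < lam) (hδ : 0 < δ)
    (hU : U ∈ Matrix.unitaryGroup (Fin m) ℂ) (hτ : τ = truncate ∨ τ = id ∧ Odd M ∧ lam ≤ 1)
    {ρ : FockSpace m →L[ℂ] FockSpace m} (hρ : IsDensity ρ)
    (hN : 64 * B ^ 2 * (M * m / ε) ^ 2 * max 1 (Real.log m) * max 1 (Real.log (1 / δ)) ≤ N) :
    1 - δ ≤ (iid N (heterodyne ρ)).real
      {γ | Aborts τ p η lam ε M U n γ ∨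
        SamplesClose M ρ (pureState (targetState U n)) (Real.sqrt lam)} := by
  have hm1 : (1 : ℝ) ≤ m := by exact_mod_cast hm
  have hM1 : (1 : ℝ) ≤ M := by exact_mod_cast hM
  -- deviations by `t` change the sum of the `M`-th powers by at most `3 m M t = 3 ε / 4 < ε`
  set t : ℝ := ε / (4 * (M * m)) with ht
  have ht0 : 0 ≤ t := by positivity
  have hmMt : m * (M * t) = ε / 4 := by rw [ht]; field_simp
  have hP : IsProbabilityMeasure (heterodyne ρ) := by
    rw [heterodyne_eq_outcome]
    exact (resolvesIdentity_coherentState m).isProbabilityMeasure_outcome hρ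
  have : IsProbabilityMeasure (iid N (heterodyne ρ)) := by unfold iid; infer_instance
  have hrad := fun i => isRadialEstimator_gEst hη (hgB i)
  have hP2 := (resolvesIdentity_rotatedFock hU).isProbabilityMeasure_outcome hρ
  refine le_measureReal_of_compl_le ((measureReal_exists_deviation_le (heterodyne ρ)
    (fun i => (hrad i).measurable_comp U i) hB (fun i γ => hgB i _) hN1 ht0).trans
      (card_mul_exp_le hm hM hB hε hδ hN)) fun γ hγ => ?_
  simp only [Set.mem_ofPred_eq, not_exists, not_le] at hγ
  refine or_iff_not_imp_left.2 fun hacc => ?_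
  rw [Aborts, not_lt, witnessEstimate] at hacc
  have hest : ∀ i, modeEstimate p η U n γ i ≤ modeFidelity U ρ i (inputPattern m n i) + t :=
    fun i => (hγ i).le.trans (by
      gcongr
      exact (hrad i).integral_heterodyne_le (fun l => modeMean_gEst_le hη hp hp' _ l) hU hρ i)
  have hτ' : τ = truncate ∨ τ = id ∧ Odd M ∧ M * t ≤ 1 := by
    refine hτ.imp id fun h => ⟨h.1, h.2.1, ?_⟩
    have : M * t ≤ m * (M * t) := le_mul_of_one_le_left (by positivity) hm1
    linarith [h.2.2]
  have hpow : ∀ i, 1 - modeFidelity U ρ i (inputPattern m n i) ^ M ≤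
      1 - τ (modeEstimate p η U n γ i) ^ M + 3 * (M * t) := fun i => by
    have h0 : 0 ≤ modeFidelity U ρ i (inputPattern m n i) := measureReal_nonneg
    have h1 : modeFidelity U ρ i (inputPattern m n i) ≤ 1 := measureReal_le_one
    linarith [truncation_pow_le h0 h1 ht0 (hest i) hτ']
  have hF := (one_sub_weight_pow_le hU hρ (inputPattern m n) M).trans
    (Finset.sum_le_sum fun i _ => hpow i)
  rw [Finset.sum_add_distrib, Finset.sum_const, Finset.card_univ, Fintype.card_fin,
    nsmul_eq_mul] at hF
  refine samplesClose_of_weight hρ ((orthonormal_rotatedFock hU).1 (inputPattern m n))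
    ((Real.sqrt_lt_sqrt_iff_of_pos (hε.trans hεl)).2 ?_)
  linarith

/-- For the target state, all estimates have mean `1`; unless one of them is less than `1 - t`, the
protocol accepts. -/
theorem completeness (hη : 0 < η) (hp : 0 < p) (hB : 0 < B)
    (hgB : ∀ i z, |(gEst p (inputPattern m n i) (inputPattern m n i) z η).re| ≤ B)
    (hm : 1 ≤ m) (hM : 1 ≤ M) (hN1 : 1 ≤ N) (hε : 0 < ε) (hεl : ε < lam) (hδ : 0 < δ)
    (hU : U ∈ Matrix.unitaryGroup (Fin m) ℂ) (hτ : τ = truncate ∨ τ = id ∧ Odd M ∧ lam ≤ 1)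
    (hN : 64 * B ^ 2 * (M * m / min ε (lam - ε)) ^ 2 * max 1 (Real.log m) *
      max 1 (Real.log (1 / δ)) ≤ N) :
    1 - δ ≤ (iid N (heterodyne (pureState (targetState U n)))).real
      {γ | ¬ Aborts τ p η lam ε M U n γ} := by
  have hm1 : (1 : ℝ) ≤ m := by exact_mod_cast hm
  have hM1 : (1 : ℝ) ≤ M := by exact_mod_cast hM
  set e := min ε (lam - ε)
  have he0 : 0 < e := lt_min hε (by linarith)
  -- here it suffices that `m M t ≤ lam - ε`
  set t : ℝ := e / (4 * (M * m)) with ht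
  have ht0 : 0 ≤ t := by positivity
  have hmMt : m * (M * t) = e / 4 := by rw [ht]; field_simp
  have hρ := isDensity_pureState ((orthonormal_rotatedFock hU).1 (inputPattern m n))
  change IsDensity (pureState (targetState U n)) at hρ
  have hP : IsProbabilityMeasure (heterodyne (pureState (targetState U n))) := by
    rw [heterodyne_eq_outcome]
    exact (resolvesIdentity_coherentState m).isProbabilityMeasure_outcome hρ
  have : IsProbabilityMeasure (iid N (heterodyne (pureState (targetState U n)))) := by
    unfold iid; infer_instance
  have hrad := fun i => isRadialEstimator_gEst hη (hgB i)
  refine le_measureReal_of_compl_le ((measureReal_exists_deviation_le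
    (heterodyne (pureState (targetState U n))) (fun i => ((hrad i).measurable_comp U i).neg) hB
      (fun i γ => (abs_neg _).trans_le (hgB i _)) hN1 ht0).trans
        (card_mul_exp_le hm hM hB he0 hδ hN)) fun γ hγ => ?_
  simp only [Set.mem_ofPred_eq, not_exists, not_le] at hγ
  have hest : ∀ i, 1 - t ≤ modeEstimate p η U n γ i := fun i => by
    have h := hγ i
    have h1 : ∫ γ, (gEst p (inputPattern m n i) (inputPattern m n i) ((Uᴴ *ᵥ γ) i) η).re
        ∂(heterodyne (pureState (targetState U n))) = 1 := by
      refine ((hrad i).integral_heterodyne_rotatedFock hU (inputPattern m n) i).trans ?_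
      rw [modeMean_gEst hη hp, if_pos rfl]
    simp only [Pi.neg_apply] at h
    rw [integral_neg, h1, Finset.sum_neg_distrib, neg_div] at h
    rw [modeEstimate]
    linarith
  have hτ' : τ = truncate ∨ τ = id ∧ Odd M ∧ M * t ≤ 1 := by
    refine hτ.imp id fun h => ⟨h.1, h.2.1, ?_⟩
    have : M * t ≤ m * (M * t) := le_mul_of_one_le_left (by positivity) hm1
    linarith [h.2.2, min_le_left ε (lam - ε)]
  have hsum := Finset.sum_le_sum fun i (_ : i ∈ (Finset.univ : Finset (Fin m))) =>
    (by linarith [le_truncation_pow hM ht0 (hest i) hτ'] :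
      1 - τ (modeEstimate p η U n γ i) ^ M ≤ M * t)
  rw [Finset.sum_const, Finset.card_univ, Fintype.card_fin, nsmul_eq_mul, hmMt] at hsum
  rw [Set.mem_ofPred_eq, Aborts, not_lt, witnessEstimate]
  linarith [min_le_right ε (lam - ε)]

end protocol

end BosonSampling

end

theorem mainTheorem1 (p : ℕ) (hp : 0 < p) (hp_even : Even p) (η : ℝ) (hη0 : 0 < η) (hη1 : η < 1) :
    ∃ C : ℝ, 0 < C ∧
      ∀ (m n M N : ℕ) (lam ε δ : ℝ) (U : Matrix (Fin m) (Fin m) ℂ) (τ : ℝ → ℝ),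
        1 ≤ m → n ≤ m → 1 ≤ M → 1 ≤ N → 0 < ε → ε < lam → 0 < δ →
        U ∈ Matrix.unitaryGroup (Fin m) ℂ →
        (τ = truncate ∨ τ = id ∧ Odd M ∧ lam ≤ 1) →
        (∀ ρ : FockSpace m →L[ℂ] FockSpace m, IsDensity ρ →
          C * (M * m / ε) ^ 2 * max 1 (Real.log m) * max 1 (Real.log (1 / δ)) ≤ N →
          1 - δ ≤ (iid N (heterodyne ρ)).real
            {γ | Aborts τ p η lam ε M U n γ ∨
              SamplesClose M ρ (pureState (targetState U n)) (Real.sqrt lam)}) ∧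
        (C * (M * m / min ε (lam - ε)) ^ 2 * max 1 (Real.log m) * max 1 (Real.log (1 / δ)) ≤ N →
          1 - δ ≤ (iid N (heterodyne (pureState (targetState U n)))).real
            {γ | ¬ Aborts τ p η lam ε M U n γ}) := by
  obtain ⟨B₀, hB₀⟩ := exists_bound_gEst hη0 hη1 p 0
  obtain ⟨B₁, hB₁⟩ := exists_bound_gEst hη0 hη1 p 1
  set B := max 1 (max B₀ B₁)
  have hBpos : 0 < B := zero_lt_one.trans_le (le_max_left _ _)
  refine ⟨64 * B ^ 2, by positivity, fun m n M N lam ε δ U τ hm _ hM hN hε hεl hδ hU hτ => ?_⟩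
  have hgB : ∀ i z, |(gEst p (inputPattern m n i) (inputPattern m n i) z η).re| ≤ B := by
    intro i z
    rw [inputPattern]
    split_ifs
    · exact (hB₁ z).trans ((le_max_right _ _).trans (le_max_right _ _))
    · exact (hB₀ z).trans ((le_max_left _ _).trans (le_max_right _ _))
  exact ⟨fun ρ hρ hNC => soundness hη0 hp hp_even hBpos hgB hm hM hN hε hεl hδ hU hτ hρ hNC,
    fun hNC => completeness hη0 hp hBpos hgB hm hM hN hε hεl hδ hU hτ hNC⟩
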